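/- **Conventions.** Manifolds are smooth Banach manifolds (the model space may vary from chart to chart; neither Hausdorff nor second countable is assumed), and submersions are split submersions. Let $n\ge 0$. A *Lie $n$-groupoid* is a simplicial manifold $K_\bullet$ such that the horn projections $p_{l,j}:K_l\to \mathrm{Hom}(\Lambda[l,j],K_\bullet)$, $0\le j\le l$, $l\ge 1$, are surjective submersions, and diffeomorphisms for $l>n$. A simplicial map $f_\bullet:K_\bullet\to J_\bullet$ of Lie $n$-groupoids is a *hypercover* if $$q_i=((d_0,\dots,d_i),f_i):K_i\to \partial_i(K_\bullet)\times_{\partial_i(J_\bullet)}J_i,\qquad \partial_i(X_\bullet)=\{(x_0,\dots,x_i)\in X_{i-1}^{i+1} : d_a x_b=d_{b-1}x_a\ \ \forall a<b\}$$ is a surjective submersion for $0\le i<n$ and a diffeomorphism for $i=n$ (for $i=0$ this is $q_0=f_0:K_0\to J_0$). Here the horn spaces and the targets of the $q_i$ carry the structure of split submanifolds of the evident finite products of the $K_l$, $J_l$. Two Lie $n$-groupoids $K_\bullet,J_\bullet$ are *Morita equivalent* if there are a Lie $n$-groupoid $Z_\bullet$ and hypercovers $Z_\bullet\to K_\bullet$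 and $Z_\bullet\to J_\bullet$. The *tangent complex* $(\mathcal T_\bullet K,\partial)$ is the complex of vector bundles over $K_0$ with $\mathcal T_0K=TK_0$, $\mathcal T_lK=\ker Tp_{l,l}|_{K_0}=\bigcap_{i<l}\ker Td_i|_{K_0}$ for $l>0$, where $K_0\subset K_l$ by iterated degeneracy, and $\partial=(-1)^l Td_l$. A chain map of complexes of vector bundles $A_\bullet\to M$, $B_\bullet\to N$ (smooth vector bundle morphisms, commuting with the differentials, over a common smooth map $M\to N$) is a *quasi-isomorphism* if the map $M\to N$ is a surjective submersion and the chain map of fibres over each point of $M$ is a quasi-isomorphism. $A_\bullet$ and $B_\bullet$ are *weakly equivalent* if some complex of vector bundles over some manifold maps to both by quasi-isomorphisms. An *$m$-shifted $2$-form* on $K_\bullet$, $m\ge 0$, is $\alpha_\bullet=\sum_{i=0}^m\alpha_i$ with $\alpha_i\in\Omega^{2+m-i}(K_i)$ normalised, i.e. all pullbacks of the $\alpha_i$ along degeneracy maps vanish. It is *closed* if $D\alpha_\bullet=0$, where $D=\delta+(-1)^p d$ on $\Omega^\bullet(K_p)$ and $\delta=\sum_i(-1)^i d_i^*$. For $x\in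 K_0$, $v\in(\mathcal T_lK)_x$, $w\in(\mathcal T_{m-l}K)_x$ put $$\lambda_x^{\alpha_\bullet}(v,w)=\sum_{\sigma\in \mathrm{Shuff}_{l,m-l}}(-1)^\sigma\,\alpha_m\big(T(s_{\sigma(m-1)}\cdots s_{\sigma(l)})v,\;T(s_{\sigma(l-1)}\cdots s_{\sigma(0)})w\big).$$ $\alpha_\bullet$ is *$m$-shifted symplectic* if it is closed and *non-degenerate*: at every $x\in K_0$ the pairing $\lambda^{\alpha_\bullet}_x$ induces a non-degenerate pairing $H_l(\mathcal T K)_x\times H_{m-l}(\mathcal T K)_x\to\mathbb R$ for every $l\in\mathbb Z$ (so $H_l(\mathcal TK)_x=0$ for $l>m$). **Statement.** 1. If $f_\bullet:K_\bullet\to J_\bullet$ is a hypercover of Lie $n$-groupoids, then the induced chain map $Tf_\bullet:\mathcal T_\bullet K\to\mathcal T_\bullet J$ of tangent complexes is a quasi-isomorphism, and each $Tf_l:(\mathcal T_lK)_x\to(\mathcal T_lJ)_{f_0(x)}$, $l\ge 0$, $x\in K_0$, is surjective. 2. If two Lie $n$-groupoids $K_\bullet$ and $J_\bullet$ are Morita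 equivalent, then their tangent complexes $\mathcal T_\bullet K$ and $\mathcal T_\bullet J$ are weakly equivalent. 3. If $\alpha_\bullet$ is an $m$-shifted symplectic form on a Lie $n$-groupoid $K_\bullet$ and $f_\bullet:J_\bullet\to K_\bullet$ is a hypercover of Lie $n$-groupoids, then $f_\bullet^*\alpha_\bullet$ is an $m$-shifted symplectic form on $J_\bullet$. -/

import Mathlib

open CategoryTheory Filter Topology
open scoped ContDiff Simplicial

universe u

noncomputable section

/-! ### Banach manifolds -/

/-- A smooth Banach manifold (without boundary, not assumed Hausdorff or second countable).
The atlas is recorded by a preferred chart around each point; the Banach space in which the chart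
takes its values may vary from point to point. The tangent space at `x` is the model space of the
preferred chart at `x`. -/
structure BanachManifold : Type (u + 1) where
  carrier : Type u
  [topology : TopologicalSpace carrier]
  model : carrier → Type u
  [normed : ∀ x, NormedAddCommGroup (model x)]
  [normedSpace : ∀ x, NormedSpace ℝ (model x)]
  [complete : ∀ x, CompleteSpace (model x)]
  chart : ∀ x, OpenPartialHomeomorph carrier (model x)
  mem_chart : ∀ x, x ∈ (chart x).source
  compatible : ∀ x y, ContDiffOn ℝ ∞ (chart y ∘ (chart x).symm)
    ((chart x).symm.trans (chart y)).source

namespace BanachManifold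

instance : CoeSort BanachManifold.{u} (Type u) := ⟨carrier⟩

attribute [instance] topology normed normedSpace complete

variable {M N P : BanachManifold.{u}}

/-- A function from a manifold to a normed space is smooth at a point. -/
def SmoothAtPoint {V : Type*} [NormedAddCommGroup V] [NormedSpace ℝ V] (g : M → V) (x : M) :
    Prop :=
  ContDiffAt ℝ ∞ (g ∘ (M.chart x).symm) (M.chart x x)

/-- Smooth maps between Banach manifolds. -/
@[ext]
structure SmoothMap (M N : BanachManifold.{u}) where
  toFun : M → N
  continuous_toFun : Continuous toFun
  smooth_toFun : ∀ x, ContDiffAt ℝ ∞ (N.chart (toFun x) ∘ toFun ∘ (M.chart x).symm) (M.chart x x)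

instance : CoeFun (SmoothMap M N) (fun _ => M → N) := ⟨SmoothMap.toFun⟩

lemma chart_symm_tendsto (x : M) : Tendsto (M.chart x).symm (𝓝 (M.chart x x)) (𝓝 x) := by
  have h := (M.chart x).continuousAt_symm ((M.chart x).map_source (M.mem_chart x))
  rwa [ContinuousAt, (M.chart x).left_inv (M.mem_chart x)] at h

lemma comp_eventuallyEq (f : SmoothMap M N) {Q : Type*} (g : N → Q) (x : M) :
    (g ∘ f) ∘ (M.chart x).symm =ᶠ[𝓝 (M.chart x x)]
      (g ∘ (N.chart (f x)).symm) ∘ (N.chart (f x) ∘ f ∘ (M.chart x).symm) := by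
  have h1 : Tendsto (f ∘ (M.chart x).symm) (𝓝 (M.chart x x)) (𝓝 (f x)) :=
    (f.continuous_toFun.tendsto x).comp (chart_symm_tendsto x)
  filter_upwards [h1 ((N.chart (f x)).open_source.mem_nhds (N.mem_chart (f x)))] with z hz
  have := (N.chart (f x)).left_inv hz
  simp only [Function.comp_apply] at this ⊢
  rw [this]

lemma rep_apply (f : SmoothMap M N) (x : M) :
    (N.chart (f x) ∘ f ∘ (M.chart x).symm) (M.chart x x) = N.chart (f x) (f x) := by
  simp [(M.chart x).left_inv (M.mem_chart x)]

lemma SmoothAtPoint.comp_smooth {V : Type*} [NormedAddCommGroup V] [NormedSpace ℝ V] {g : N → V}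
    (f : SmoothMap M N) {x : M} (hg : SmoothAtPoint g (f x)) : SmoothAtPoint (g ∘ f) x := by
  refine ContDiffAt.congr_of_eventuallyEq ?_ (comp_eventuallyEq f g x)
  refine ContDiffAt.comp _ ?_ (f.smooth_toFun x)
  rw [rep_apply]
  exact hg

def SmoothMap.id (M : BanachManifold.{u}) : SmoothMap M M where
  toFun := fun x => x
  continuous_toFun := continuous_id
  smooth_toFun := fun x => by
    refine (contDiffAt_id (𝕜 := ℝ)).congr_of_eventuallyEq ?_
    filter_upwards [(M.chart x).open_target.mem_nhds ((M.chart x).map_source (M.mem_chart x))]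
      with z hz
    simp [(M.chart x).right_inv hz]

def SmoothMap.comp (g : SmoothMap N P) (f : SmoothMap M N) : SmoothMap M P where
  toFun := g ∘ f
  continuous_toFun := g.continuous_toFun.comp f.continuous_toFun
  smooth_toFun := fun x => by
    have h : SmoothAtPoint (P.chart (g (f x)) ∘ g) (f x) := g.smooth_toFun (f x)
    exact h.comp_smooth f

/-- The category of Banach manifolds and smooth maps. -/
instance : Category BanachManifold.{u} where
  Hom := SmoothMap
  id := SmoothMap.id
  comp f g := SmoothMap.comp g f

/-- The underlying map of a morphism of Banach manifolds. -/
def app (f : M ⟶ N) : M → N := SmoothMap.toFun f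

/-- The tangent map `T_x f : T_x M → T_y N` of a smooth map with `f x = y`. -/
def tangentMap (f : M ⟶ N) {x : M} {y : N} (_h : app f x = y) : M.model x →L[ℝ] N.model y :=
  fderiv ℝ (N.chart y ∘ app f ∘ (M.chart x).symm) (M.chart x x)

lemma hasFDerivAt_rep (f : M ⟶ N) {x : M} {y : N} (h : app f x = y) :
    HasFDerivAt (N.chart y ∘ app f ∘ (M.chart x).symm) (tangentMap f h) (M.chart x x) := by
  subst h
  exact ((SmoothMap.smooth_toFun f x).differentiableAt (by simp)).hasFDerivAt

lemma tangentMap_comp (f : M ⟶ N) (g : N ⟶ P) {x : M} {y : N} {z : P} (h : app f x = y)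
    (h' : app g y = z) (h'' : app (f ≫ g) x = z) :
    tangentMap (f ≫ g) h'' = (tangentMap g h').comp (tangentMap f h) := by
  subst h
  refine (hasFDerivAt_rep (f ≫ g) h'').unique ?_
  refine HasFDerivAt.congr_of_eventuallyEq ?_ (comp_eventuallyEq f (P.chart z ∘ app g) x)
  refine HasFDerivAt.comp _ ?_ (hasFDerivAt_rep f rfl)
  have h1 := hasFDerivAt_rep g h'
  have h2 : (N.chart (app f x) ∘ app f ∘ (M.chart x).symm) (M.chart x x) =
    N.chart (app f x) (app f x) := rep_apply f x
  rw [← h2] at h1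
  exact h1

lemma tangentMap_id {x : M} (h : app (𝟙 M) x = x) :
    tangentMap (𝟙 M) h = ContinuousLinearMap.id ℝ _ := by
  refine (hasFDerivAt_rep (𝟙 M) h).unique ?_
  refine (hasFDerivAt_id _).congr_of_eventuallyEq ?_
  filter_upwards [(M.chart x).open_target.mem_nhds ((M.chart x).map_source (M.mem_chart x))]
    with z hz
  exact (M.chart x).right_inv hz

/-- Finite products of Banach manifolds. -/
def pi {ι : Type} [Fintype ι] (M : ι → BanachManifold.{u}) : BanachManifold.{u} where
  carrier := ∀ i, M i
  model := fun x => ∀ i, (M i).model (x i)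
  chart := fun x => OpenPartialHomeomorph.pi fun i => (M i).chart (x i)
  mem_chart := fun x i _ => (M i).mem_chart (x i)
  compatible := fun x y => by
    rw [contDiffOn_pi]
    intro i
    have h := (M i).compatible (x i) (y i)
    refine h.comp
      (ContinuousLinearMap.proj (R := ℝ) (φ := fun i => (M i).model (x i)) i).contDiff.contDiffOn ?_
    rintro z ⟨hz1, hz2⟩
    exact ⟨hz1 i trivial, hz2 i trivial⟩

/-- The product of two Banach manifolds. -/
def prod (M N : BanachManifold.{u}) : BanachManifold.{u} where
  carrier := M × N
  model := fun x => M.model x.1 × N.model x.2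
  chart := fun x => (M.chart x.1).prod (N.chart x.2)
  mem_chart := fun x => ⟨M.mem_chart x.1, N.mem_chart x.2⟩
  compatible := fun x y => by
    refine ContDiffOn.prodMk ?_ ?_
    · refine (M.compatible x.1 y.1).comp contDiff_fst.contDiffOn ?_
      rintro z ⟨hz1, hz2⟩
      exact ⟨hz1.1, hz2.1⟩
    · refine (N.compatible x.2 y.2).comp contDiff_snd.contDiffOn ?_
      rintro z ⟨hz1, hz2⟩
      exact ⟨hz1.2, hz2.2⟩

/-- The map into a finite product with given components. -/
def lift {ι : Type} [Fintype ι] {M : ι → BanachManifold.{u}} {L : BanachManifold.{u}}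
    (f : ∀ i, L ⟶ M i) : L ⟶ pi M where
  toFun := fun x i => app (f i) x
  continuous_toFun := continuous_pi fun i => SmoothMap.continuous_toFun (f i)
  smooth_toFun := fun x => contDiffAt_pi.2 fun i => SmoothMap.smooth_toFun (f i) x

/-- The map into a product of two manifolds with given components. -/
def pair {L : BanachManifold.{u}} (f : L ⟶ M) (g : L ⟶ N) : L ⟶ prod M N where
  toFun := fun x => (app f x, app g x)
  continuous_toFun :=
    (SmoothMap.continuous_toFun f).prodMk (SmoothMap.continuous_toFun g)
  smooth_toFun := fun x =>
    (SmoothMap.smooth_toFun f x).prodMk (SmoothMap.smooth_toFun g x)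

/-- A chart belonging to the maximal smooth atlas of `M`. -/
def IsSmoothChart {E : Type*} [NormedAddCommGroup E] [NormedSpace ℝ E]
    (φ : OpenPartialHomeomorph M E) : Prop :=
  ∀ x ∈ φ.source, ContDiffAt ℝ ∞ (φ ∘ (M.chart x).symm) (M.chart x x) ∧
    ContDiffAt ℝ ∞ (M.chart x ∘ φ.symm) (φ x)

/-- `f : M → N` is a surjective (split) submersion onto a (split) submanifold `S` of `N`: its image
is `S`, and around each point of `M` there are a chart of `M` with values in a product of Banach
spaces `F × H`, and a chart of `N` with values in a product of Banach spaces `F × G` in which `S`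
is given by the equation `G = 0`, such that in these charts `f` is the projection of `F × H` to
`F × 0`. For `S = N` this is the usual notion of a surjective submersion. -/
def IsSurjSubmersionOnto (f : M ⟶ N) (S : Set N) : Prop :=
  Set.range (app f) = S ∧ ∀ x : M,
    ∃ (F G H : Type u) (_ : NormedAddCommGroup F) (_ : NormedSpace ℝ F) (_ : CompleteSpace F)
      (_ : NormedAddCommGroup G) (_ : NormedSpace ℝ G) (_ : CompleteSpace G)
      (_ : NormedAddCommGroup H) (_ : NormedSpace ℝ H) (_ : CompleteSpace H)
      (φ : OpenPartialHomeomorph M (F × H)) (ψ : OpenPartialHomeomorph N (F × G)),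
      IsSmoothChart φ ∧ IsSmoothChart ψ ∧ x ∈ φ.source ∧
      (∀ y ∈ ψ.source, y ∈ S ↔ (ψ y).2 = 0) ∧
      ∀ y ∈ φ.source, app f y ∈ ψ.source ∧ ψ (app f y) = ((φ y).1, 0)

/-- `f : M → N` is a diffeomorphism onto a (split) submanifold `S` of `N`: it is a bijection onto
`S` which in suitable charts, adapted to `S` as above, is the identification of `F` with `F × 0`. -/
def IsDiffeoOnto (f : M ⟶ N) (S : Set N) : Prop :=
  Set.range (app f) = S ∧ Function.Injective (app f) ∧ ∀ x : M,
    ∃ (F G : Type u) (_ : NormedAddCommGroup F) (_ : NormedSpace ℝ F) (_ : CompleteSpace F)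
      (_ : NormedAddCommGroup G) (_ : NormedSpace ℝ G) (_ : CompleteSpace G)
      (φ : OpenPartialHomeomorph M F) (ψ : OpenPartialHomeomorph N (F × G)),
      IsSmoothChart φ ∧ IsSmoothChart ψ ∧ x ∈ φ.source ∧
      (∀ y ∈ ψ.source, y ∈ S ↔ (ψ y).2 = 0) ∧
      ∀ y ∈ φ.source, app f y ∈ ψ.source ∧ ψ (app f y) = (φ y, 0)

end BanachManifold

namespace BanachManifold

variable {M N P : BanachManifold.{u}}

/-! ### Derivatives in charts -/

section ChartCalculus

variable {E E' : Type u} [NormedAddCommGroup E] [NormedSpace ℝ E] [NormedAddCommGroup E']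
  [NormedSpace ℝ E']

/-- The derivative at `y` of a chart. -/
def chartD (φ : OpenPartialHomeomorph M E) (y : M) : M.model y →L[ℝ] E :=
  fderiv ℝ (φ ∘ (M.chart y).symm) (M.chart y y)

/-- The derivative at `φ y` of the inverse of a chart. -/
def chartDInv (φ : OpenPartialHomeomorph M E) (y : M) : E →L[ℝ] M.model y :=
  fderiv ℝ (M.chart y ∘ φ.symm) (φ y)

/-- The derivative at `φ y` of the expression of a smooth map in charts `φ`, `φ'`. -/
def localD (φ : OpenPartialHomeomorph M E) (φ' : OpenPartialHomeomorph N E') (g : M ⟶ N) (y : M) :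
    E →L[ℝ] E' :=
  fderiv ℝ (φ' ∘ app g ∘ φ.symm) (φ y)

lemma app_id (y : M) : app (𝟙 M) y = y := rfl

lemma app_comp (f : M ⟶ N) (g : N ⟶ P) (x : M) : app (f ≫ g) x = app g (app f x) := rfl

lemma chartDInv_chartD {φ : OpenPartialHomeomorph M E} (hφ : IsSmoothChart φ) {y : M}
    (hy : y ∈ φ.source) (v : M.model y) : chartDInv φ y (chartD φ y v) = v := by
  have h1 : HasFDerivAt (φ ∘ (M.chart y).symm) (chartD φ y) (M.chart y y) :=
    ((hφ y hy).1.differentiableAt (by simp)).hasFDerivAt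
  have h2 : HasFDerivAt (M.chart y ∘ φ.symm) (chartDInv φ y) (φ y) :=
    ((hφ y hy).2.differentiableAt (by simp)).hasFDerivAt
  have e : (φ ∘ (M.chart y).symm) (M.chart y y) = φ y := by
    simp [(M.chart y).left_inv (M.mem_chart y)]
  rw [← e] at h2
  have h3 := h2.comp _ h1
  have h4 : HasFDerivAt ((M.chart y ∘ φ.symm) ∘ φ ∘ (M.chart y).symm)
      (ContinuousLinearMap.id ℝ (M.model y)) (M.chart y y) := by
    refine (hasFDerivAt_id _).congr_of_eventuallyEq ?_
    filter_upwards [(M.chart y).open_target.mem_nhds ((M.chart y).map_source (M.mem_chart y)),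
      chart_symm_tendsto y (φ.open_source.mem_nhds hy)] with z hz1 hz2
    have := φ.left_inv hz2
    simp only [Function.comp_apply] at this ⊢
    rw [this, (M.chart y).right_inv hz1]
    rfl
  have := congrArg (fun L => L v) (h3.unique h4)
  simpa using this

lemma symm_tendsto {Q : Type*} [TopologicalSpace Q] (φ : OpenPartialHomeomorph M Q) {y : M} (hy : y ∈ φ.source) :
    Tendsto φ.symm (𝓝 (φ y)) (𝓝 y) := by
  have h := φ.continuousAt_symm (φ.map_source hy)
  rwa [ContinuousAt, φ.left_inv hy] at h

lemma chartD_chartDInv {φ : OpenPartialHomeomorph M E} (hφ : IsSmoothChart φ) {y : M}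
    (hy : y ∈ φ.source) (v : E) : chartD φ y (chartDInv φ y v) = v := by
  have h1 : HasFDerivAt (φ ∘ (M.chart y).symm) (chartD φ y) (M.chart y y) :=
    ((hφ y hy).1.differentiableAt (by simp)).hasFDerivAt
  have h2 : HasFDerivAt (M.chart y ∘ φ.symm) (chartDInv φ y) (φ y) :=
    ((hφ y hy).2.differentiableAt (by simp)).hasFDerivAt
  have e : (M.chart y ∘ φ.symm) (φ y) = M.chart y y := by
    simp [φ.left_inv hy]
  rw [← e] at h1
  have h3 := h1.comp _ h2
  have h4 : HasFDerivAt ((φ ∘ (M.chart y).symm) ∘ M.chart y ∘ φ.symm)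
      (ContinuousLinearMap.id ℝ E) (φ y) := by
    refine (hasFDerivAt_id _).congr_of_eventuallyEq ?_
    filter_upwards [φ.open_target.mem_nhds (φ.map_source hy),
      symm_tendsto φ hy ((M.chart y).open_source.mem_nhds (M.mem_chart y))] with z hz1 hz2
    have := (M.chart y).left_inv hz2
    simp only [Function.comp_apply] at this ⊢
    rw [this, φ.right_inv hz1]
    rfl
  have := congrArg (fun L => L v) (h3.unique h4)
  simpa using this

lemma localRep_eventuallyEq {φ : OpenPartialHomeomorph M E} {φ' : OpenPartialHomeomorph N E'}
    (g : M ⟶ N) {y : M} (hy : y ∈ φ.source) :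
    φ' ∘ app g ∘ φ.symm =ᶠ[𝓝 (φ y)]
      (φ' ∘ (N.chart (app g y)).symm) ∘ (N.chart (app g y) ∘ app g ∘ (M.chart y).symm) ∘
        (M.chart y ∘ φ.symm) := by
  have h1 : Tendsto φ.symm (𝓝 (φ y)) (𝓝 y) := symm_tendsto φ hy
  have h2 : Tendsto (app g) (𝓝 y) (𝓝 (app g y)) := (SmoothMap.continuous_toFun g).tendsto y
  filter_upwards [h1 ((M.chart y).open_source.mem_nhds (M.mem_chart y)),
    (h2.comp h1) ((N.chart (app g y)).open_source.mem_nhds (N.mem_chart _))] with z hz1 hz2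
  have e1 := (M.chart y).left_inv hz1
  have e2 := (N.chart (app g y)).left_inv hz2
  simp only [Function.comp_apply] at e1 e2 ⊢
  rw [e1, e2]

lemma localRep_contDiffAt {φ : OpenPartialHomeomorph M E} {φ' : OpenPartialHomeomorph N E'}
    (hφ : IsSmoothChart φ) (hφ' : IsSmoothChart φ') (g : M ⟶ N) {y : M} (hy : y ∈ φ.source)
    (hgy : app g y ∈ φ'.source) : ContDiffAt ℝ ∞ (φ' ∘ app g ∘ φ.symm) (φ y) := by
  refine ContDiffAt.congr_of_eventuallyEq ?_ (localRep_eventuallyEq g hy)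
  have e1 : (M.chart y ∘ φ.symm) (φ y) = M.chart y y := by simp [φ.left_inv hy]
  have e2 : (N.chart (app g y) ∘ app g ∘ (M.chart y).symm) (M.chart y y) =
    N.chart (app g y) (app g y) := rep_apply g y
  refine ContDiffAt.comp _ ?_ (ContDiffAt.comp _ ?_ (hφ y hy).2)
  · rw [Function.comp_apply, e1, e2]
    exact (hφ' _ hgy).1
  · rw [e1]
    exact SmoothMap.smooth_toFun g y

lemma localD_eq {φ : OpenPartialHomeomorph M E} {φ' : OpenPartialHomeomorph N E'}
    (hφ : IsSmoothChart φ) (hφ' : IsSmoothChart φ') (g : M ⟶ N) {y : M} {z : N}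
    (hz : app g y = z) (hy : y ∈ φ.source) (hgy : z ∈ φ'.source) :
    localD φ φ' g y = (chartD φ' z).comp ((tangentMap g hz).comp (chartDInv φ y)) := by
  subst hz
  have h1 : HasFDerivAt (φ' ∘ (N.chart (app g y)).symm) (chartD φ' (app g y))
      (N.chart (app g y) (app g y)) := ((hφ' _ hgy).1.differentiableAt (by simp)).hasFDerivAt
  have h2 : HasFDerivAt (M.chart y ∘ φ.symm) (chartDInv φ y) (φ y) :=
    ((hφ y hy).2.differentiableAt (by simp)).hasFDerivAt
  have h3 := hasFDerivAt_rep g (x := y) rfl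
  have e1 : (M.chart y ∘ φ.symm) (φ y) = M.chart y y := by simp [φ.left_inv hy]
  have e2 : (N.chart (app g y) ∘ app g ∘ (M.chart y).symm) (M.chart y y) =
    N.chart (app g y) (app g y) := rep_apply g y
  rw [← e2] at h1
  have h4 := h1.comp _ h3
  rw [← e1] at h4
  have h5 := h4.comp _ h2
  exact (h5.congr_of_eventuallyEq (localRep_eventuallyEq g hy)).fderiv

lemma localD_smoothAtPoint {φ : OpenPartialHomeomorph M E} {φ' : OpenPartialHomeomorph N E'}
    (hφ : IsSmoothChart φ) (hφ' : IsSmoothChart φ') (g : M ⟶ N) {y : M} (hy : y ∈ φ.source)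
    (hgy : app g y ∈ φ'.source) : SmoothAtPoint (localD φ φ' g) y := by
  have h1 : ContDiffAt ℝ ∞ (fderiv ℝ (φ' ∘ app g ∘ φ.symm)) (φ y) :=
    (localRep_contDiffAt hφ hφ' g hy hgy).fderiv_right (by simp)
  have e : (φ ∘ (M.chart y).symm) (M.chart y y) = φ y := by
    simp [(M.chart y).left_inv (M.mem_chart y)]
  rw [← e] at h1
  exact h1.comp _ (hφ y hy).1

end ChartCalculus

/-- The preferred charts belong to the maximal atlas. -/
lemma isSmoothChart_chart (x : M) : IsSmoothChart (M.chart x) := by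
  intro y hy
  constructor
  · refine (M.compatible y x).contDiffAt (OpenPartialHomeomorph.open_source _ |>.mem_nhds ?_)
    refine ⟨(M.chart y).map_source (M.mem_chart y), ?_⟩
    simpa [(M.chart y).left_inv (M.mem_chart y)] using hy
  · refine (M.compatible x y).contDiffAt (OpenPartialHomeomorph.open_source _ |>.mem_nhds ?_)
    refine ⟨(M.chart x).map_source hy, ?_⟩
    simpa [(M.chart x).left_inv hy] using M.mem_chart y

end BanachManifold

/-! ### Banach vector bundles and complexes of vector bundles -/

/-- A smooth vector bundle with Banach fibres over a Banach manifold: around each point `a` there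
is a local trivialisation with some Banach space `model a` as typical fibre, and the transition
functions are smooth for the operator norm. The maps `triv a x` and `trivInv a x` are meaningful
for `x` in the open set `base a` only. -/
structure BanachBundle (M : BanachManifold.{u}) where
  fiber : M → Type u
  [normed : ∀ x, NormedAddCommGroup (fiber x)]
  [normedSpace : ∀ x, NormedSpace ℝ (fiber x)]
  [complete : ∀ x, CompleteSpace (fiber x)]
  model : M → Type u
  [modelNormed : ∀ a, NormedAddCommGroup (model a)]
  [modelNormedSpace : ∀ a, NormedSpace ℝ (model a)]
  [modelComplete : ∀ a, CompleteSpace (model a)]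
  base : M → Set M
  isOpen_base : ∀ a, IsOpen (base a)
  mem_base : ∀ a, a ∈ base a
  triv : ∀ a x, fiber x →L[ℝ] model a
  trivInv : ∀ a x, model a →L[ℝ] fiber x
  left_inv : ∀ a x, x ∈ base a → ∀ v, trivInv a x (triv a x v) = v
  right_inv : ∀ a x, x ∈ base a → ∀ v, triv a x (trivInv a x v) = v
  smooth_transition : ∀ a b x, x ∈ base a → x ∈ base b →
    BanachManifold.SmoothAtPoint (fun y => (triv b y).comp (trivInv a y)) x

namespace BanachBundle

attribute [instance] normed normedSpace complete modelNormed modelNormedSpace modelComplete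

variable {M N : BanachManifold.{u}}

/-- A family of continuous linear maps `A_x → B_{f x}` is a smooth morphism of vector bundles
over `f : M → N`: it is smooth in local trivialisations, for the operator norm. -/
def IsSmoothHom (f : M ⟶ N) (A : BanachBundle M) (B : BanachBundle N)
    (φ : ∀ x, A.fiber x →L[ℝ] B.fiber (BanachManifold.app f x)) : Prop :=
  ∀ a b x, x ∈ A.base a → BanachManifold.app f x ∈ B.base b →
    BanachManifold.SmoothAtPoint
      (fun y => (B.triv b (BanachManifold.app f y)).comp ((φ y).comp (A.trivInv a y))) x

end BanachBundle

/-- A chain complex of vector bundles over `M`, concentrated in degrees `≥ 0`. -/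
structure BundleComplex (M : BanachManifold.{u}) where
  bundle : ℕ → BanachBundle M
  d : ∀ l x, (bundle (l + 1)).fiber x →L[ℝ] (bundle l).fiber x
  smooth_d : ∀ l, BanachBundle.IsSmoothHom (𝟙 M) (bundle (l + 1)) (bundle l) (d l)
  d_comp_d : ∀ l x v, d l x (d (l + 1) x v) = 0

/-- A chain map of complexes of vector bundles, covering a smooth map of the bases. -/
structure BundleComplexHom {M N : BanachManifold.{u}} (A : BundleComplex M)
    (B : BundleComplex N) where
  baseMap : M ⟶ N
  map : ∀ l x, (A.bundle l).fiber x →L[ℝ] (B.bundle l).fiber (BanachManifold.app baseMap x)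
  smooth_map : ∀ l, BanachBundle.IsSmoothHom baseMap (A.bundle l) (B.bundle l) (map l)
  comm : ∀ l x v, map l x (A.d l x v) = B.d l _ (map (l + 1) x v)

/-- The chain complex of vector spaces over a point of the base. -/
def BundleComplex.fiberComplex {M : BanachManifold.{u}} (A : BundleComplex M) (x : M) :
    ChainComplex (ModuleCat.{u} ℝ) ℕ :=
  ChainComplex.of (fun l => ModuleCat.of ℝ ((A.bundle l).fiber x))
    (fun l => ModuleCat.ofHom (A.d l x).toLinearMap)
    (fun l => by
      ext v
      exact A.d_comp_d l x v)

/-- The chain map induced over a point of the base. -/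
def BundleComplexHom.fiberMap {M N : BanachManifold.{u}} {A : BundleComplex M}
    {B : BundleComplex N} (f : BundleComplexHom A B) (x : M) :
    A.fiberComplex x ⟶ B.fiberComplex (BanachManifold.app f.baseMap x) :=
  ChainComplex.ofHom (fun l => ModuleCat.ofHom (f.map l x).toLinearMap)
    (fun l => by
      have h1 : (A.fiberComplex x).d (l + 1) l = ModuleCat.ofHom (A.d l x).toLinearMap :=
        ChainComplex.of_d (fun l => ModuleCat.of ℝ ((A.bundle l).fiber x))
          (fun l => ModuleCat.ofHom (A.d l x).toLinearMap) l
      have h2 : (B.fiberComplex (BanachManifold.app f.baseMap x)).d (l + 1) l =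
          ModuleCat.ofHom (B.d l (BanachManifold.app f.baseMap x)).toLinearMap :=
        ChainComplex.of_d
          (fun l => ModuleCat.of ℝ ((B.bundle l).fiber (BanachManifold.app f.baseMap x)))
          (fun l => ModuleCat.ofHom (B.d l (BanachManifold.app f.baseMap x)).toLinearMap) l
      rw [h1, h2]
      ext v
      exact (f.comm l x v).symm)

/-- A chain map of complexes of vector bundles is a quasi-isomorphism if it covers a surjective
submersion and is a quasi-isomorphism over each point of the base of its source. -/
def BundleComplexHom.IsQuasiIso {M N : BanachManifold.{u}} {A : BundleComplex M}
    {B : BundleComplex N} (f : BundleComplexHom A B) : Prop :=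
  BanachManifold.IsSurjSubmersionOnto f.baseMap Set.univ ∧ ∀ x, QuasiIso (f.fiberMap x)

/-- Two complexes of vector bundles are weakly equivalent if a third one maps to both of them by
quasi-isomorphisms. -/
def BundleComplex.WeaklyEquivalent {M N : BanachManifold.{u}} (A : BundleComplex M)
    (B : BundleComplex N) : Prop :=
  ∃ (L : BanachManifold.{u}) (C : BundleComplex L) (f : BundleComplexHom C A)
    (g : BundleComplexHom C B), f.IsQuasiIso ∧ g.IsQuasiIso

/-! ### Subbundles of tangent bundles along a map -/

namespace BanachManifold

variable {M N M' N' : BanachManifold.{u}}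

/-- A chart of `N` around `s a` which identifies, at all points `s x` in its domain, the given
subspace of `T_{s x} N` with the second summand `0 × H` of `F × H`. -/
structure SubbundleChart (s : M ⟶ N) (S : ∀ x, Submodule ℝ (N.model (app s x))) (a : M) where
  F : Type u
  H : Type u
  [normedF : NormedAddCommGroup F]
  [normedSpaceF : NormedSpace ℝ F]
  [completeF : CompleteSpace F]
  [normedH : NormedAddCommGroup H]
  [normedSpaceH : NormedSpace ℝ H]
  [completeH : CompleteSpace H]
  φ : OpenPartialHomeomorph N (F × H)
  smooth_φ : IsSmoothChart φ
  mem_φ : app s a ∈ φ.source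
  mem_iff : ∀ x, app s x ∈ φ.source → ∀ v, v ∈ S x ↔ (chartD φ (app s x) v).1 = 0

namespace SubbundleChart

attribute [instance] normedF normedSpaceF completeF normedH normedSpaceH completeH

variable {s : M ⟶ N} {S : ∀ x, Submodule ℝ (N.model (app s x))}

lemma isClosed {a : M} (c : SubbundleChart s S a) : IsClosed (S a : Set (N.model (app s a))) := by
  have : (S a : Set (N.model (app s a))) =
      (fun v => (chartD c.φ (app s a) v).1) ⁻¹' {0} := by
    ext v
    exact c.mem_iff a c.mem_φ v
  rw [this]
  exact isClosed_singleton.preimage ((chartD c.φ (app s a)).continuous.fst)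

def triv {a : M} (c : SubbundleChart s S a) (x : M) : S x →L[ℝ] c.H :=
  (ContinuousLinearMap.snd ℝ c.F c.H).comp ((chartD c.φ (app s x)).comp (S x).subtypeL)

def preInv {a : M} (c : SubbundleChart s S a) (x : M) : c.H →L[ℝ] N.model (app s x) :=
  (chartDInv c.φ (app s x)).comp (ContinuousLinearMap.inr ℝ c.F c.H)

lemma preInv_mem {a : M} (c : SubbundleChart s S a) {x : M} (hx : app s x ∈ c.φ.source)
    (w : c.H) : c.preInv x w ∈ S x := by
  rw [c.mem_iff x hx]
  simp [preInv, chartD_chartDInv c.smooth_φ hx]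

open Classical in
def trivInv {a : M} (c : SubbundleChart s S a) (x : M) : c.H →L[ℝ] S x :=
  if hx : app s x ∈ c.φ.source then (c.preInv x).codRestrict (S x) (c.preInv_mem hx) else 0

lemma trivInv_apply {a : M} (c : SubbundleChart s S a) {x : M} (hx : app s x ∈ c.φ.source)
    (w : c.H) : (c.trivInv x w : N.model (app s x)) = chartDInv c.φ (app s x) (0, w) := by
  simp [trivInv, hx, preInv]

lemma left_inv {a : M} (c : SubbundleChart s S a) {x : M} (hx : app s x ∈ c.φ.source)
    (v : S x) : c.trivInv x (c.triv x v) = v := by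
  apply Subtype.ext
  rw [c.trivInv_apply hx]
  have h : ((0 : c.F), c.triv x v) = chartD c.φ (app s x) v :=
    Prod.ext ((c.mem_iff x hx v).1 v.2).symm rfl
  rw [h, chartDInv_chartD c.smooth_φ hx]

lemma right_inv {a : M} (c : SubbundleChart s S a) {x : M} (hx : app s x ∈ c.φ.source)
    (w : c.H) : c.triv x (c.trivInv x w) = w := by
  have h : c.triv x (c.trivInv x w) = (chartD c.φ (app s x) (c.trivInv x w)).2 := rfl
  rw [h, c.trivInv_apply hx, chartD_chartDInv c.smooth_φ hx]

/-- The tangent map of a smooth map, restricted to subbundles, is smooth. -/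
lemma smooth_of_tangentMap {s' : M' ⟶ N'} {S' : ∀ x, Submodule ℝ (N'.model (app s' x))}
    {a : M} {b : M'} (c : SubbundleChart s S a) (c' : SubbundleChart s' S' b) (f : M ⟶ M')
    (g : N ⟶ N') (h : ∀ x, app g (app s x) = app s' (app f x)) (r : ℝ)
    (φ : ∀ x, S x →L[ℝ] S' (app f x))
    (hφ : ∀ x v, (φ x v : N'.model (app s' (app f x))) = r • tangentMap g (h x) v) {x : M}
    (hx : app s x ∈ c.φ.source) (hx' : app s' (app f x) ∈ c'.φ.source) :
    SmoothAtPoint (fun y => (c'.triv (app f y)).comp ((φ y).comp (c.trivInv y))) x := by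
  have hgx : app g (app s x) ∈ c'.φ.source := by rw [h]; exact hx'
  have h1 : SmoothAtPoint (localD c.φ c'.φ g ∘ app s) x :=
    SmoothAtPoint.comp_smooth s (localD_smoothAtPoint c.smooth_φ c'.smooth_φ g hx hgx)
  have h2 : SmoothAtPoint (fun y => r • (ContinuousLinearMap.snd ℝ c'.F c'.H).comp
      ((localD c.φ c'.φ g (app s y)).comp (ContinuousLinearMap.inr ℝ c.F c.H))) x := by
    have := ((contDiffAt_const (c := ContinuousLinearMap.snd ℝ c'.F c'.H)).clm_comp
      (ContDiffAt.clm_comp h1 (contDiffAt_const (c := ContinuousLinearMap.inr ℝ c.F c.H))))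
    exact this.const_smul r
  refine ContDiffAt.congr_of_eventuallyEq h2 ?_
  have t1 : ∀ᶠ y in 𝓝 x, app s y ∈ c.φ.source :=
    (SmoothMap.continuous_toFun s).continuousAt.preimage_mem_nhds
      (c.φ.open_source.mem_nhds hx)
  have t2 : ∀ᶠ y in 𝓝 x, app s' (app f y) ∈ c'.φ.source :=
    (SmoothMap.continuous_toFun (f ≫ s')).continuousAt.preimage_mem_nhds
      (c'.φ.open_source.mem_nhds hx')
  filter_upwards [(chart_symm_tendsto x).eventually t1, (chart_symm_tendsto x).eventually t2]
    with z hz1 hz2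
  ext w
  simp only [Function.comp_apply]
  rw [localD_eq c.smooth_φ c'.smooth_φ g (h _) hz1 hz2]
  have e : ∀ (y : M) (w : S y), c'.triv (app f y) (φ y w) =
    (chartD c'.φ (app s' (app f y)) (φ y w)).2 := fun _ _ => rfl
  simp [e, hφ, c.trivInv_apply hz1]

end SubbundleChart

/-- The vector bundle whose fibres are given subspaces `S x` of `T_{s x} N`. -/
def subbundle (s : M ⟶ N) (S : ∀ x, Submodule ℝ (N.model (app s x)))
    (c : ∀ a, SubbundleChart s S a) : BanachBundle M where
  fiber := fun x => S x
  complete := fun x => (c x).isClosed.completeSpace_coe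
  model := fun a => (c a).H
  base := fun a => app s ⁻¹' (c a).φ.source
  isOpen_base := fun a => (c a).φ.open_source.preimage (SmoothMap.continuous_toFun s)
  mem_base := fun a => (c a).mem_φ
  triv := fun a x => (c a).triv x
  trivInv := fun a x => (c a).trivInv x
  left_inv := fun a _ hx v => (c a).left_inv hx v
  right_inv := fun a _ hx w => (c a).right_inv hx w
  smooth_transition := fun a b x ha hb => by
    have := SubbundleChart.smooth_of_tangentMap (c a) (c b) (𝟙 M) (𝟙 N) (fun _ => rfl) 1
      (fun x => ContinuousLinearMap.id ℝ (S x))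
      (fun x v => by
        rw [one_smul]
        exact (DFunLike.congr_fun (tangentMap_id rfl) (v : N.model (app s x))).symm) ha hb
    exact this

end BanachManifold

/-! ### Simplicial manifolds, Lie `n`-groupoids and hypercovers -/

/-- A simplicial manifold is a contravariant functor from `Δ` to Banach manifolds. -/
abbrev SimplicialManifold := SimplicialObject BanachManifold.{u}

namespace SimplicialManifold

open BanachManifold Opposite

/-- The map from the `(k+1)`-simplices to the product of the `k`-simplices indexed by all faces
except the `j`-th one. -/
def hornMap (X : SimplicialManifold.{u}) (k : ℕ) (j : Fin (k + 2)) :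
    X _⦋k + 1⦌ ⟶ pi (fun _ : {i : Fin (k + 2) // i ≠ j} => X _⦋k⦌) :=
  lift fun i => X.δ i.1

/-- The horn space `Hom(Λ[k+1, j], X)`: families `(x_i)` of `k`-simplices, `i ≠ j`, such that
`d_a x_b = d_{b-1} x_a` whenever `a < b` (below, `b` is written as a successor). -/
def hornSpace (X : SimplicialManifold.{u}) : ∀ (k : ℕ) (j : Fin (k + 2)),
    Set (pi (fun _ : {i : Fin (k + 2) // i ≠ j} => X _⦋k⦌)) := fun k j => match k, j with
  | 0, _ => Set.univ
  | k + 1, j => Set.ofPred fun x : {i : Fin (k + 3) // i ≠ j} → X _⦋k + 1⦌ =>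
      ∀ (a b : Fin (k + 2)) (ha : a.castSucc ≠ j) (hb : b.succ ≠ j), a ≤ b →
        app (X.δ a) (x ⟨b.succ, hb⟩) = app (X.δ b) (x ⟨a.castSucc, ha⟩)

/-- The boundary space `∂_{k+1}(X)`: families `(x_0, …, x_{k+1})` of `k`-simplices such that
`d_a x_b = d_{b-1} x_a` whenever `a < b`. -/
def boundarySpace (X : SimplicialManifold.{u}) : ∀ k : ℕ, Set (Fin (k + 2) → X _⦋k⦌) :=
  fun k => match k with
  | 0 => Set.univ
  | k + 1 => {x | ∀ a b : Fin (k + 2), a ≤ b →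
      app (X.δ a) (x b.succ) = app (X.δ b) (x a.castSucc)}

/-- The map `q_{k+1} = ((d_0, …, d_{k+1}), f_{k+1})`. -/
def matchingMap {K J : SimplicialManifold.{u}} (f : K ⟶ J) (k : ℕ) :
    K _⦋k + 1⦌ ⟶ prod (pi (fun _ : Fin (k + 2) => K _⦋k⦌)) (J _⦋k + 1⦌) :=
  pair (lift fun i => K.δ i) (f.app (op ⦋k + 1⦌))

/-- The fibre product `∂_{k+1}(K) ×_{∂_{k+1}(J)} J_{k+1}`. -/
def matchingSpace {K J : SimplicialManifold.{u}} (f : K ⟶ J) (k : ℕ) :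
    Set (prod (pi (fun _ : Fin (k + 2) => K _⦋k⦌)) (J _⦋k + 1⦌)) :=
  Set.ofPred fun z : (Fin (k + 2) → K _⦋k⦌) × J _⦋k + 1⦌ =>
    z.1 ∈ boundarySpace K k ∧ ∀ i, app (f.app (op ⦋k⦌)) (z.1 i) = app (J.δ i) z.2

end SimplicialManifold

open SimplicialManifold BanachManifold Opposite

/-- A Lie `n`-groupoid: a simplicial manifold whose horn projections
`p_{l,j} : X_l → Hom(Λ[l, j], X)`, `l ≥ 1`, are surjective submersions, and diffeomorphisms for
`l > n`. Here `l = k + 1`, and the manifold structure of the horn space is the one of a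
submanifold of a power of `X_k`. -/
structure LieNGroupoid (n : ℕ) where
  X : SimplicialManifold.{u}
  horn_submersion : ∀ k j, IsSurjSubmersionOnto (hornMap X k j) (hornSpace X k j)
  horn_diffeo : ∀ k j, n < k + 1 → IsDiffeoOnto (hornMap X k j) (hornSpace X k j)

/-- A simplicial map `f : K → J` is a hypercover if
`q_i : K_i → ∂_i(K) ×_{∂_i(J)} J_i` is a surjective submersion for `0 ≤ i < n` and a
diffeomorphism for `i = n`. For `i = 0` this is the map `f_0 : K_0 → J_0`. -/
structure IsHypercover {n : ℕ} {K J : LieNGroupoid.{u} n} (f : K.X ⟶ J.X) : Prop where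
  zero_submersion : 0 < n → IsSurjSubmersionOnto (f.app (op ⦋0⦌)) Set.univ
  zero_diffeo : n = 0 → IsDiffeoOnto (f.app (op ⦋0⦌)) Set.univ
  succ_submersion : ∀ k, k + 1 < n → IsSurjSubmersionOnto (matchingMap f k) (matchingSpace f k)
  succ_diffeo : ∀ k, k + 1 = n → IsDiffeoOnto (matchingMap f k) (matchingSpace f k)

/-- Morita equivalence of Lie `n`-groupoids. -/
def MoritaEquivalent {n : ℕ} (K J : LieNGroupoid.{u} n) : Prop :=
  ∃ (Z : LieNGroupoid.{u} n) (f : Z.X ⟶ K.X) (g : Z.X ⟶ J.X),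
    IsHypercover (K := Z) (J := K) f ∧ IsHypercover (K := Z) (J := J) g

/-! ### The tangent complex -/

namespace SimplicialManifold

variable (X : SimplicialManifold.{u}) {K J : SimplicialManifold.{u}}

/-- The iterated degeneracy `X_0 → X_l`. -/
def degen (Δ : SimplexCategory) : X _⦋0⦌ ⟶ X.obj (op Δ) :=
  X.map (SimplexCategory.const Δ ⦋0⦌ 0).op

/-- A point of `X_0`, viewed as a point of `X_l`. -/
abbrev pt (x : X _⦋0⦌) (Δ : SimplexCategory) : X.obj (op Δ) := app (degen X Δ) x

lemma map_pt {Δ Δ' : SimplexCategory} (θ : Δ ⟶ Δ') (x : X _⦋0⦌) :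
    app (X.map θ.op) (pt X x Δ') = pt X x Δ := by
  have h : degen X Δ' ≫ X.map θ.op = degen X Δ := by
    rw [degen, degen, ← X.map_comp, ← op_comp]
    rfl
  exact congrArg (fun g => app g x) h

/-- The structure maps of the simplicial vector space `T_x X`, for `x` in `X_0`. -/
def T (x : X _⦋0⦌) {Δ Δ' : SimplexCategory} (θ : Δ ⟶ Δ') :
    (X.obj (op Δ')).model (pt X x Δ') →L[ℝ] (X.obj (op Δ)).model (pt X x Δ) :=
  tangentMap (X.map θ.op) (map_pt X θ x)

lemma T_comp (x : X _⦋0⦌) {Δ Δ' Δ'' : SimplexCategory} (θ : Δ ⟶ Δ') (θ' : Δ' ⟶ Δ'')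
    (v : (X.obj (op Δ'')).model (pt X x Δ'')) : T X x (θ ≫ θ') v = T X x θ (T X x θ' v) := by
  have h : ∀ (g : X.obj (op Δ'') ⟶ X.obj (op Δ)) (hg : app g (pt X x Δ'') = pt X x Δ),
      g = X.map θ'.op ≫ X.map θ.op → tangentMap g hg v = T X x θ (T X x θ' v) := by
    rintro g hg rfl
    rw [tangentMap_comp _ _ (map_pt X θ' x) (map_pt X θ x)]
    rfl
  exact h _ _ (by rw [op_comp, X.map_comp])

/-- The fibre over `x` of the tangent complex: `T_x X_0` in degree `0` and, in degree `l > 0`, the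
kernel of the tangent map of `p_{l,l} = (d_0, …, d_{l-1})`, that is, the common kernel of
`T d_0, …, T d_{l-1}`. -/
def tangentFiber : ∀ (l : ℕ) (x : X _⦋0⦌),
    Submodule ℝ ((X.obj (op ⦋l⦌)).model (pt X x ⦋l⦌)) := fun l x => match l, x with
  | 0, _ => ⊤
  | l + 1, x => ⨅ i : {i : Fin (l + 2) // i ≠ Fin.last (l + 1)},
      LinearMap.ker (T X x (SimplexCategory.δ i.1)).toLinearMap

lemma mem_tangentFiber_succ {l : ℕ} {x : X _⦋0⦌}
    {v : (X.obj (op ⦋l + 1⦌)).model (pt X x ⦋l + 1⦌)} :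
    v ∈ tangentFiber X (l + 1) x ↔
      ∀ i : Fin (l + 2), i ≠ Fin.last (l + 1) → T X x (SimplexCategory.δ i) v = 0 := by
  simp only [tangentFiber, Submodule.mem_iInf, Subtype.forall]
  rfl

lemma tangentD_mem (l : ℕ) (x : X _⦋0⦌) (v : tangentFiber X (l + 1) x) :
    T X x (SimplexCategory.δ (Fin.last (l + 1))) v.1 ∈ tangentFiber X l x := by
  cases l with
  | zero => trivial
  | succ l =>
    rw [mem_tangentFiber_succ]
    intro i hi
    have h := SimplexCategory.δ_comp_δ (Fin.le_last i)
    rw [Fin.succ_last] at h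
    rw [← T_comp X, h, T_comp X, (mem_tangentFiber_succ X).1 v.2 i.castSucc (Fin.castSucc_ne_last i),
      map_zero]

/-- The differential `∂ = (-1)^l T d_l` of the tangent complex, from degree `l = k + 1`. -/
def tangentD (k : ℕ) (x : X _⦋0⦌) : tangentFiber X (k + 1) x →L[ℝ] tangentFiber X k x :=
  (-1 : ℝ) ^ (k + 1) • ((T X x (SimplexCategory.δ (Fin.last (k + 1)))).comp
    (tangentFiber X (k + 1) x).subtypeL).codRestrict (tangentFiber X k x) (tangentD_mem X k x)

lemma tangentD_apply (k : ℕ) (x : X _⦋0⦌) (v : tangentFiber X (k + 1) x) :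
    (tangentD X k x v : (X.obj (op ⦋k⦌)).model (pt X x ⦋k⦌)) =
      (-1 : ℝ) ^ (k + 1) • T X x (SimplexCategory.δ (Fin.last (k + 1))) v.1 := rfl

lemma tangentD_tangentD (k : ℕ) (x : X _⦋0⦌) (v : tangentFiber X (k + 2) x) :
    tangentD X k x (tangentD X (k + 1) x v) = 0 := by
  apply Subtype.ext
  have h := SimplexCategory.δ_comp_δ (le_refl (Fin.last (k + 1)))
  rw [Fin.succ_last] at h
  have h0 := (mem_tangentFiber_succ X).1 v.2 _ (Fin.castSucc_ne_last (Fin.last (k + 1)))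
  rw [tangentD_apply, tangentD_apply, map_smul, ← T_comp X, h, T_comp X, h0]
  simp

/-- In degree `0` the fibres are the whole tangent spaces. -/
lemma nonempty_subbundleChart_zero (a : X _⦋0⦌) :
    Nonempty (SubbundleChart (degen X ⦋0⦌) (tangentFiber X 0) a) := by
  let E := (X.obj (op ⦋0⦌)).model (app (degen X ⦋0⦌) a)
  let e : E ≃L[ℝ] PUnit.{u + 1} × E := (ContinuousLinearEquiv.uniqueProd ℝ E PUnit.{u + 1}).symm
  let c := (X.obj (op ⦋0⦌)).chart (app (degen X ⦋0⦌) a)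
  refine ⟨{ F := PUnit.{u + 1}, H := E, φ := c.transHomeomorph e.toHomeomorph,
            smooth_φ := ?_, mem_φ := ?_, mem_iff := ?_ }⟩
  · intro x hx
    have hs := isSmoothChart_chart (M := X.obj (op ⦋0⦌)) (app (degen X ⦋0⦌) a) x hx
    refine ⟨(e.contDiff.contDiffAt).comp _ hs.1, ?_⟩
    have h2 := hs.2
    have h3 : e.symm (e (c x)) = c x := e.symm_apply_apply _
    change ContDiffAt ℝ ∞ (((X.obj (op ⦋0⦌)).chart x ∘ c.symm) ∘ e.symm) (e (c x))
    refine ContDiffAt.comp _ ?_ e.symm.contDiff.contDiffAt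
    rw [h3]
    exact h2
  · exact (X.obj (op ⦋0⦌)).mem_chart _
  · intro x _ v
    exact ⟨fun _ => rfl, fun _ => trivial⟩

end SimplicialManifold

namespace LieNGroupoid

variable {n : ℕ} (K : LieNGroupoid.{u} n) {J : LieNGroupoid.{u} n}

lemma tangentMap_lift_eq_zero_iff {ι : Type} [Fintype ι] {M : ι → BanachManifold.{u}}
    {L : BanachManifold.{u}} (f : ∀ i, L ⟶ M i) (x : L) (v : L.model x) (y : ∀ i, M i)
    (hy : ∀ i, app (f i) x = y i) :
    tangentMap (lift f) (x := x) (y := app (lift f) x) rfl v = 0 ↔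
      ∀ i, tangentMap (f i) (hy i) v = 0 := by
  obtain rfl : (fun i => app (f i) x) = y := funext hy
  have h : HasFDerivAt
      (fun z i => ((M i).chart (app (f i) x) ∘ app (f i) ∘ (L.chart x).symm) z)
      (ContinuousLinearMap.pi fun i => tangentMap (f i) (x := x) rfl) (L.chart x x) :=
    hasFDerivAt_pi.2 fun i => hasFDerivAt_rep (f i) rfl
  have e : tangentMap (lift f) (x := x) (y := app (lift f) x) rfl =
      ContinuousLinearMap.pi fun i => tangentMap (f i) (x := x) rfl := h.fderiv
  rw [e]
  exact funext_iff

/-- In degree `l > 0` the kernel of the tangent map of `p_{l,l}` is a subbundle, because `p_{l,l}`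
is a submersion. -/
lemma nonempty_subbundleChart_succ (k : ℕ) (a : K.X _⦋0⦌) :
    Nonempty (SubbundleChart (degen K.X ⦋k + 1⦌) (tangentFiber K.X (k + 1)) a) := by
  obtain ⟨F, G, H, _, _, _, _, _, _, _, _, _, φ, ψ, hφ, hψ, ha, -, hp⟩ :=
    (K.horn_submersion k (Fin.last (k + 1))).2 (pt K.X a ⦋k + 1⦌)
  refine ⟨{ F := F, H := H, φ := φ, smooth_φ := hφ, mem_φ := ha, mem_iff := ?_ }⟩
  intro x hx v
  have hpx := (hp _ hx).1
  have h1 := localD_eq hφ hψ (hornMap K.X k (Fin.last (k + 1))) rfl hx hpx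
  have h2 : localD φ ψ (hornMap K.X k (Fin.last (k + 1))) (pt K.X x ⦋k + 1⦌) =
      (ContinuousLinearMap.inl ℝ F G).comp (ContinuousLinearMap.fst ℝ F H) := by
    refine HasFDerivAt.fderiv (HasFDerivAt.congr_of_eventuallyEq
      ((ContinuousLinearMap.inl ℝ F G).comp (ContinuousLinearMap.fst ℝ F H)).hasFDerivAt ?_)
    filter_upwards [φ.open_target.mem_nhds (φ.map_source hx)] with z hz
    have := (hp _ (φ.map_target hz)).2
    rw [φ.right_inv hz] at this
    exact this
  have h3 := DFunLike.congr_fun (h1.symm.trans h2) (chartD φ (pt K.X x ⦋k + 1⦌) v)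
  simp only [ContinuousLinearMap.comp_apply, chartDInv_chartD hφ hx] at h3
  have h4 : v ∈ tangentFiber K.X (k + 1) x ↔
      tangentMap (hornMap K.X k (Fin.last (k + 1))) (x := pt K.X x ⦋k + 1⦌) rfl v = 0 := by
    rw [mem_tangentFiber_succ]
    refine Iff.trans ?_ (tangentMap_lift_eq_zero_iff
      (fun i : {i : Fin (k + 2) // i ≠ Fin.last (k + 1)} => K.X.δ i.1) (pt K.X x ⦋k + 1⦌) v
      (fun _ => pt K.X x ⦋k⦌) (fun i => map_pt K.X (SimplexCategory.δ i.1) x)).symm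
    exact ⟨fun h i => h i.1 i.2, fun h i hi => h ⟨i, hi⟩⟩
  rw [h4]
  constructor
  · intro h
    rw [h, map_zero] at h3
    exact (congrArg Prod.fst h3).symm
  · intro h
    have h5 : (ContinuousLinearMap.inl ℝ F G) ((ContinuousLinearMap.fst ℝ F H)
        (chartD φ (pt K.X x ⦋k + 1⦌) v)) = 0 := by
      rw [ContinuousLinearMap.coe_fst', h, map_zero]
    rw [h5] at h3
    rw [← chartDInv_chartD hψ hpx (tangentMap _ _ v), h3, map_zero]

lemma nonempty_subbundleChart (l : ℕ) (a : K.X _⦋0⦌) :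
    Nonempty (SubbundleChart (degen K.X ⦋l⦌) (tangentFiber K.X l) a) := by
  cases l with
  | zero => exact nonempty_subbundleChart_zero K.X a
  | succ k => exact K.nonempty_subbundleChart_succ k a

/-- A chart adapted to the tangent complex. -/
def subbundleChart (l : ℕ) (a : K.X _⦋0⦌) :
    SubbundleChart (degen K.X ⦋l⦌) (tangentFiber K.X l) a :=
  Classical.choice (K.nonempty_subbundleChart l a)

/-- The tangent complex of a Lie `n`-groupoid, a complex of vector bundles over `X_0`. -/
def tangentComplex : BundleComplex (K.X _⦋0⦌) where
  bundle := fun l => subbundle (degen K.X ⦋l⦌) (tangentFiber K.X l) (K.subbundleChart l)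
  d := fun l x => tangentD K.X l x
  smooth_d := fun l a b x ha hb =>
    SubbundleChart.smooth_of_tangentMap (K.subbundleChart (l + 1) a) (K.subbundleChart l b) (𝟙 _)
      (K.X.δ (Fin.last (l + 1))) (fun x => map_pt K.X (SimplexCategory.δ (Fin.last (l + 1))) x)
      ((-1) ^ (l + 1)) (fun x => tangentD K.X l x) (fun x v => tangentD_apply K.X l x v) ha hb
  d_comp_d := fun l x v => tangentD_tangentD K.X l x v

variable {K}

lemma app_pt (f : K.X ⟶ J.X) (x : K.X _⦋0⦌) (Δ : SimplexCategory) :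
    app (f.app (op Δ)) (pt K.X x Δ) = pt J.X (app (f.app (op ⦋0⦌)) x) Δ :=
  congrArg (fun g => app g x) (f.naturality (SimplexCategory.const Δ ⦋0⦌ 0).op)

/-- The tangent map of a simplicial map, at the points of `X_0`. -/
def tangentAt (f : K.X ⟶ J.X) (x : K.X _⦋0⦌) (Δ : SimplexCategory) :
    (K.X.obj (op Δ)).model (pt K.X x Δ) →L[ℝ]
      (J.X.obj (op Δ)).model (pt J.X (app (f.app (op ⦋0⦌)) x) Δ) :=
  tangentMap (f.app (op Δ)) (app_pt f x Δ)

lemma tangentAt_T (f : K.X ⟶ J.X) (x : K.X _⦋0⦌) {Δ Δ' : SimplexCategory} (θ : Δ ⟶ Δ')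
    (v : (K.X.obj (op Δ')).model (pt K.X x Δ')) :
    tangentAt f x Δ (T K.X x θ v) = T J.X (app (f.app (op ⦋0⦌)) x) θ (tangentAt f x Δ' v) := by
  have h : ∀ (g g' : K.X.obj (op Δ') ⟶ J.X.obj (op Δ)) (hg : app g (pt K.X x Δ') = _)
      (hg' : app g' (pt K.X x Δ') = pt J.X (app (f.app (op ⦋0⦌)) x) Δ),
      g = g' → tangentMap g hg v = tangentMap g' hg' v := by
    rintro g g' hg hg' rfl
    rfl
  have h1 := h (K.X.map θ.op ≫ f.app (op Δ)) (f.app (op Δ') ≫ J.X.map θ.op)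
    (by rw [app_comp, map_pt, app_pt]) (by rw [app_comp, app_pt, map_pt]) (f.naturality θ.op)
  rw [tangentMap_comp _ _ (map_pt K.X θ x) (app_pt f x Δ),
    tangentMap_comp _ _ (app_pt f x Δ') (map_pt J.X θ _)] at h1
  exact h1

lemma tangentAt_mem (f : K.X ⟶ J.X) (l : ℕ) (x : K.X _⦋0⦌) (v : tangentFiber K.X l x) :
    tangentAt f x ⦋l⦌ v.1 ∈ tangentFiber J.X l (app (f.app (op ⦋0⦌)) x) := by
  cases l with
  | zero => trivial
  | succ l =>
    rw [mem_tangentFiber_succ]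
    intro i hi
    rw [← tangentAt_T, (mem_tangentFiber_succ K.X).1 v.2 i hi, map_zero]

/-- The chain map of tangent complexes induced by a simplicial map of Lie `n`-groupoids. -/
def tangentHom (f : K.X ⟶ J.X) : BundleComplexHom K.tangentComplex J.tangentComplex where
  baseMap := f.app (op ⦋0⦌)
  map := fun l x => ((tangentAt f x ⦋l⦌).comp (tangentFiber K.X l x).subtypeL).codRestrict
    (tangentFiber J.X l (app (f.app (op ⦋0⦌)) x)) (tangentAt_mem f l x)
  smooth_map := fun l a b x ha hb =>
    SubbundleChart.smooth_of_tangentMap (K.subbundleChart l a) (J.subbundleChart l b)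
      (f.app (op ⦋0⦌)) (f.app (op ⦋l⦌)) (fun x => app_pt f x ⦋l⦌) 1 _
      (fun x v => (one_smul ℝ _).symm) ha hb
  comm := fun l x v => by
    apply Subtype.ext
    change tangentAt f x ⦋l⦌ ((-1 : ℝ) ^ (l + 1) • T K.X x _ _) =
      (-1 : ℝ) ^ (l + 1) • T J.X _ _ (tangentAt f x ⦋l + 1⦌ _)
    rw [map_smul, tangentAt_T]

end LieNGroupoid

/-! ### Differential forms on simplicial manifolds -/

/-- A (not necessarily smooth) differential form of degree `q` on `M`. -/
abbrev Form (M : BanachManifold.{u}) (q : ℕ) := ∀ x : M, M.model x [⋀^Fin q]→L[ℝ] ℝ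

namespace Form

variable {M N : BanachManifold.{u}} {q : ℕ}

/-- The expression of a form in the preferred chart at `x`. -/
def rep (η : Form M q) (x : M) (z : M.model x) : M.model x [⋀^Fin q]→L[ℝ] ℝ :=
  (η ((M.chart x).symm z)).compContinuousLinearMap
    (chartDInv (M.chart x) ((M.chart x).symm z))

/-- Smoothness of a differential form. -/
def IsSmooth (η : Form M q) : Prop := ∀ x, ContDiffOn ℝ ∞ (η.rep x) (M.chart x).target

/-- The de Rham differential, computed at each point in the preferred chart. -/
def deRham (η : Form M q) : Form M (q + 1) := fun x => extDeriv (η.rep x) (M.chart x x)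

/-- The pullback of a form along a smooth map. -/
def pullback (f : M ⟶ N) (η : Form N q) : Form M q :=
  fun x => (η (app f x)).compContinuousLinearMap (tangentMap f rfl)

end Form

namespace SimplicialManifold

variable (X : SimplicialManifold.{u})

/-- Families of forms `α p q` of degree `q` on `X_p`: the underlying bigraded object of the
simplicial de Rham double complex. -/
abbrev BiForm := ∀ p q : ℕ, Form (X _⦋p⦌) q

variable {X}

namespace BiForm

/-- The simplicial differential `δ = ∑ (-1)^i d_i^*`. -/
def simplicialD (α : BiForm X) : BiForm X := fun p q => match p with
  | 0 => 0
  | p + 1 => ∑ i : Fin (p + 2), (-1 : ℝ) ^ (i : ℕ) • Form.pullback (X.δ i) (α p q)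

/-- The de Rham differential. -/
def deRham (α : BiForm X) : BiForm X := fun p q => match q with
  | 0 => 0
  | q + 1 => Form.deRham (α p q)

/-- The total differential `D = δ + (-1)^p d`. -/
def totalD (α : BiForm X) : BiForm X := fun p q =>
  α.simplicialD p q + (-1 : ℝ) ^ p • α.deRham p q

/-- The pullback along a simplicial map. -/
def pullback {Y : SimplicialManifold.{u}} (f : Y ⟶ X) (α : BiForm X) : BiForm Y := fun p q =>
  Form.pullback (f.app (op ⦋p⦌)) (α p q)

/-- A form is normalised if it vanishes on degeneracies. -/
def IsNormalised (α : BiForm X) : Prop :=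
  ∀ (p q : ℕ) (i : Fin (p + 1)), Form.pullback (X.σ i) (α (p + 1) q) = 0

/-- An `m`-shifted `k`-form: a sum of smooth normalised forms `α_p` of degree `k + m - p` on `X_p`,
for `p = 0, …, m`. -/
def IsShiftedForm (m k : ℕ) (α : BiForm X) : Prop :=
  (∀ p q, (α p q).IsSmooth) ∧ (∀ p q, ¬ (p ≤ m ∧ p + q = k + m) → α p q = 0) ∧ α.IsNormalised

/-- A form is closed if its total differential vanishes. -/
def IsClosed (α : BiForm X) : Prop := ∀ p q, α.totalD p q = 0

end BiForm

/-- `σ` is an `(l, m - l)`-shuffle of `{0, …, m - 1}`. -/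
def IsShuffle {m : ℕ} (l : ℕ) (σ : Equiv.Perm (Fin m)) : Prop :=
  (∀ i j : Fin m, i < j → (j : ℕ) < l → σ i < σ j) ∧
    ∀ i j : Fin m, i < j → l ≤ (i : ℕ) → σ i < σ j

/-- The order preserving map `[m] → [r]` sending `i` to the number of elements of `A` smaller than
`i`, where `A` is a subset of `{0, …, m - 1}` with `r` elements. If `b_1 < … < b_s` are the
elements of the complement of `A`, the induced map `X_r → X_m` of a simplicial object is the
iterated degeneracy `s_{b_s} ⋯ s_{b_1}`. -/
def collapse {m r : ℕ} (A : Finset (Fin m)) (hA : A.card = r) :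
    (⦋m⦌ : SimplexCategory) ⟶ ⦋r⦌ :=
  SimplexCategory.mkHom
    { toFun := fun i => ⟨(A.filter fun a : Fin m => (a : ℕ) < i).card,
        Nat.lt_succ_of_le ((Finset.card_filter_le _ _).trans hA.le)⟩
      monotone' := fun i j hij => by
        refine Finset.card_le_card (Finset.monotone_filter_right _ ?_)
        intro a _ ha
        exact lt_of_lt_of_le ha hij }

lemma card_left {l r m : ℕ} (h : l + r = m) (σ : Equiv.Perm (Fin m)) :
    (Finset.univ.filter fun a : Fin m => (σ.symm a : ℕ) < l).card = l := by
  have e : (Finset.univ.filter fun a : Fin m => (σ.symm a : ℕ) < l) =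
      (Finset.univ.filter fun a : Fin m => (a : ℕ) < l).map σ.toEmbedding := by
    ext a
    simp
  rw [e, Finset.card_map, Fin.card_filter_val_lt]
  omega

lemma card_right {l r m : ℕ} (h : l + r = m) (σ : Equiv.Perm (Fin m)) :
    (Finset.univ.filter fun a : Fin m => l ≤ (σ.symm a : ℕ)).card = r := by
  have h1 := Finset.card_filter_add_card_filter_not (s := (Finset.univ : Finset (Fin m)))
    (fun a : Fin m => (σ.symm a : ℕ) < l)
  rw [card_left h σ, Finset.card_univ, Fintype.card_fin] at h1
  simp only [not_lt] at h1
  omega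

open Classical in
/-- The pairing `λ_x(v, w) = ∑_σ (-1)^σ α_m(T(s_{σ(m-1)} ⋯ s_{σ(l)}) v, T(s_{σ(l-1)} ⋯ s_{σ(0)}) w)`
over all `(l, r)`-shuffles `σ`, where `l + r = m`. -/
def imPairing {m l r : ℕ} (h : l + r = m) (α : BiForm X) (x : X _⦋0⦌) (v : tangentFiber X l x)
    (w : tangentFiber X r x) : ℝ :=
  ∑ σ : Equiv.Perm (Fin m), if IsShuffle l σ then
    ((Equiv.Perm.sign σ : ℤ) : ℝ) * α m 2 (pt X x ⦋m⦌)
      ![T X x (collapse _ (card_left h σ)) v.1, T X x (collapse _ (card_right h σ)) w.1]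
  else 0

end SimplicialManifold

namespace LieNGroupoid

variable {n : ℕ} (K : LieNGroupoid.{u} n)

/-- The homology of the tangent complex at `x`. -/
abbrev homologyAt (x : K.X _⦋0⦌) (l : ℕ) : ModuleCat.{u} ℝ :=
  (K.tangentComplex.fiberComplex x).homology l

/-- The cycles of the tangent complex at `x`. -/
abbrev cyclesAt (x : K.X _⦋0⦌) (l : ℕ) : ModuleCat.{u} ℝ :=
  (K.tangentComplex.fiberComplex x).cycles l

/-- The inclusion of the cycles. -/
def cycleVal (x : K.X _⦋0⦌) (l : ℕ) (v : K.cyclesAt x l) : tangentFiber K.X l x :=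
  ((K.tangentComplex.fiberComplex x).iCycles l).hom v

/-- The homology class of a cycle. -/
def cycleClass (x : K.X _⦋0⦌) (l : ℕ) (v : K.cyclesAt x l) : K.homologyAt x l :=
  ((K.tangentComplex.fiberComplex x).homologyπ l).hom v

/-- An `m`-shifted `2`-form is non-degenerate if, at each point of `X_0`, the pairing `λ` induces
non-degenerate pairings `H_l × H_{m-l} → ℝ` on the homology of the tangent complex. For `l > m`,
where `H_{m-l} = 0`, this means that `H_l = 0`. -/
def IsNondegenerate (m : ℕ) (α : BiForm K.X) : Prop :=
  ∀ x : K.X _⦋0⦌,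
    (∀ (l r : ℕ) (h : l + r = m), ∃ B : K.homologyAt x l →ₗ[ℝ] K.homologyAt x r →ₗ[ℝ] ℝ,
      (∀ v w, B (K.cycleClass x l v) (K.cycleClass x r w) =
        imPairing h α x (K.cycleVal x l v) (K.cycleVal x r w)) ∧ B.Nondegenerate) ∧
    ∀ l, m < l → Subsingleton (K.homologyAt x l)

/-- An `m`-shifted symplectic form on a Lie `n`-groupoid: a closed, normalised, non-degenerate
`m`-shifted `2`-form. -/
def IsShiftedSymplectic (m : ℕ) (α : BiForm K.X) : Prop :=
  α.IsShiftedForm m 2 ∧ α.IsClosed ∧ K.IsNondegenerate m α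

end LieNGroupoid

end

/-!
The tangent complex of `K` at `x` consists of the normalised chains of the simplicial vector space
`T_x K`, so that everything rests on one linear lifting property of the tangent map of a hypercover
`f : K → J` (`IsHypercover.exists_tangent_lift`): if `v` is a cycle of `𝒯_k K` (any vector if
`k = 0`), `w` lies in `𝒯_{k+1} J` and `∂w = Tf v`, then there is `u` in `𝒯_{k+1} K` with `∂u = v`
and `Tf u = w`. Together with the surjectivity of `T f_0`, this shows that cycles lift to cycles,
that cycles with bounding image bound, and that `Tf` is surjective in every degree.

In degrees `k + 1 ≤ n` the matching map `q_{k+1}` is a submersion onto the fibre product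
`∂_{k+1}(K) ×_{∂_{k+1}(J)} J_{k+1}`. What has to be shown is that `((0, …, 0, ±v), w)`, which
satisfies the linearised equations of this fibre product, really is tangent to it. It is enough to
find a curve in the fibre product with this velocity, differentiable at time `0`
(`IsSurjSubmersionOnto.exists_tangentMap_eq`), and curves lift through submersions with any
prescribed compatible velocity (`IsSurjSubmersionOnto.exists_lift`). Lifting a constant horn through
the last horn projection of `J` gives a curve `y` with velocity `w` whose faces other than the last
one are fixed; lifting the last face of `y` through `q_k` gives a curve of `k`-simplices of `K` with
velocity `±v` and fixed boundary (`IsHypercover.exists_curve`). With fixed degenerate simplices as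
the remaining faces, these two curves form a curve in the fibre product.

In degrees `k ≥ n` the lifting property degenerates: the tangent complexes vanish above degree `n`
because the horn projections are diffeomorphisms there, and `q_n` is an immersion.

For shifted symplectic forms, the pullback commutes with both differentials
(`Form.deRham_pullback`, `BiForm.simplicialD_pullback`), and the pairing `λ` is natural
(`LieNGroupoid.imPairing_pullback`), so that the pairing on homology is transported along the
isomorphism induced by the quasi-isomorphism `Tf`.
-/

noncomputable section

open SimplicialManifold BanachManifold Opposite

namespace BanachManifold

variable {M N P : BanachManifold.{u}}

/-! ### Velocities of curves -/

/-- The curve `c` passes through `y` at time `0` with velocity `v`. Differentiability is only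
required at time `0`. -/
structure HasVelocity (c : ℝ → M) (y : M) (v : M.model y) : Prop where
  apply_zero : c 0 = y
  continuousAt : ContinuousAt c 0
  hasDerivAt : HasDerivAt (M.chart y ∘ c) v 0


section ChartVelocity

variable {E : Type u} [NormedAddCommGroup E] [NormedSpace ℝ E]

lemma HasVelocity.chart {c : ℝ → M} {y : M} {v : M.model y} (h : HasVelocity c y v)
    {φ : OpenPartialHomeomorph M E} (hφ : IsSmoothChart φ) (hy : y ∈ φ.source) :
    HasDerivAt (φ ∘ c) (chartD φ y v) 0 := by
  have h1 : HasFDerivAt (φ ∘ (M.chart y).symm) (chartD φ y) (M.chart y y) :=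
    ((hφ y hy).1.differentiableAt (by simp)).hasFDerivAt
  have e : (M.chart y ∘ c) 0 = M.chart y y := by simp [h.apply_zero]
  rw [← e] at h1
  refine (h1.comp_hasDerivAt 0 h.hasDerivAt).congr_of_eventuallyEq ?_
  have hc : Tendsto c (𝓝 0) (𝓝 y) := by
    have := h.continuousAt
    rwa [ContinuousAt, h.apply_zero] at this
  filter_upwards [hc ((M.chart y).open_source.mem_nhds (M.mem_chart y))] with t ht
  have := (M.chart y).left_inv ht
  simp only [Function.comp_apply] at this ⊢
  rw [this]

lemma HasVelocity.tendsto {c : ℝ → M} {y : M} {v : M.model y} (h : HasVelocity c y v) :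
    Tendsto c (𝓝 0) (𝓝 y) := by
  have := h.continuousAt
  rwa [ContinuousAt, h.apply_zero] at this

/-- A differentiable curve in the target of a chart is the expression of a curve in the
manifold. -/
lemma hasVelocity_symm {φ : OpenPartialHomeomorph M E} (hφ : IsSmoothChart φ) {y : M}
    (hy : y ∈ φ.source) {γ : ℝ → E} {w : E} (hγ : HasDerivAt γ w 0) (h0 : γ 0 = φ y) :
    HasVelocity (φ.symm ∘ γ) y (chartDInv φ y w) where
  apply_zero := by simp [h0, φ.left_inv hy]
  continuousAt := by
    refine ContinuousAt.comp ?_ hγ.continuousAt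
    rw [h0]
    exact φ.continuousAt_symm (φ.map_source hy)
  hasDerivAt := by
    have h2 : HasFDerivAt (M.chart y ∘ φ.symm) (chartDInv φ y) (φ y) :=
      ((hφ y hy).2.differentiableAt (by simp)).hasFDerivAt
    rw [← h0] at h2
    exact h2.comp_hasDerivAt 0 hγ

end ChartVelocity

lemma HasVelocity.const (y : M) : HasVelocity (fun _ => y) y 0 where
  apply_zero := rfl
  continuousAt := continuousAt_const
  hasDerivAt := hasDerivAt_const 0 _

lemma exists_hasVelocity {y : M} (v : M.model y) : ∃ c : ℝ → M, HasVelocity c y v := by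
  have h : HasDerivAt (fun t : ℝ => M.chart y y + t • v) v 0 := by
    simpa using ((hasDerivAt_id (0 : ℝ)).smul_const v).const_add (M.chart y y)
  have h1 := hasVelocity_symm (isSmoothChart_chart y) (M.mem_chart y) h (by simp)
  have h2 : chartDInv (M.chart y) y v = v := by
    rw [chartDInv]
    have : M.chart y ∘ (M.chart y).symm =ᶠ[𝓝 (M.chart y y)] id := by
      filter_upwards [(M.chart y).open_target.mem_nhds ((M.chart y).map_source (M.mem_chart y))]
        with z hz
      exact (M.chart y).right_inv hz
    rw [this.fderiv_eq, fderiv_id]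
    rfl
  rw [h2] at h1
  exact ⟨_, h1⟩

lemma HasVelocity.map {c : ℝ → M} {y : M} {v : M.model y} (h : HasVelocity c y v) (f : M ⟶ N)
    {z : N} (hz : app f y = z) : HasVelocity (fun t => app f (c t)) z (tangentMap f hz v) where
  apply_zero := by rw [h.apply_zero, hz]
  continuousAt :=
    ContinuousAt.comp (SmoothMap.continuous_toFun f).continuousAt h.continuousAt
  hasDerivAt := by
    have h1 := hasFDerivAt_rep f hz
    have e : (M.chart y ∘ c) 0 = M.chart y y := by simp [h.apply_zero]
    rw [← e] at h1
    refine (h1.comp_hasDerivAt 0 h.hasDerivAt).congr_of_eventuallyEq ?_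
    filter_upwards [h.tendsto ((M.chart y).open_source.mem_nhds (M.mem_chart y))] with t ht
    have := (M.chart y).left_inv ht
    simp only [Function.comp_apply] at this ⊢
    rw [this]

lemma HasVelocity.pi {ι : Type} [Fintype ι] {M : ι → BanachManifold.{u}} {c : ℝ → ∀ i, M i}
    {y : ∀ i, M i} {v : ∀ i, (M i).model (y i)}
    (h : ∀ i, HasVelocity (fun t => c t i) (y i) (v i)) :
    HasVelocity (M := BanachManifold.pi M) c y v where
  apply_zero := funext fun i => (h i).apply_zero
  continuousAt := continuousAt_pi.2 fun i => (h i).continuousAt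
  hasDerivAt := hasDerivAt_pi.2 fun i => (h i).hasDerivAt

lemma HasVelocity.prodMk {c : ℝ → M} {c' : ℝ → N} {y : M} {y' : N} {v : M.model y}
    {v' : N.model y'} (h : HasVelocity c y v) (h' : HasVelocity c' y' v') :
    HasVelocity (M := prod M N) (fun t => (c t, c' t)) (y, y') (v, v') where
  apply_zero := Prod.ext h.apply_zero h'.apply_zero
  continuousAt := h.continuousAt.prodMk h'.continuousAt
  hasDerivAt := h.hasDerivAt.prodMk h'.hasDerivAt

/-! ### Tangent maps into products -/

lemma tangentMap_lift {ι : Type} [Fintype ι] {M : ι → BanachManifold.{u}} {L : BanachManifold.{u}}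
    (f : ∀ i, L ⟶ M i) {x : L} {y : ∀ i, M i} (hy : ∀ i, app (f i) x = y i)
    (h : app (lift f) x = y) (v : L.model x) :
    tangentMap (lift f) (y := y) h v = fun i => tangentMap (f i) (hy i) v := by
  have e : HasFDerivAt (fun z i => ((M i).chart (y i) ∘ app (f i) ∘ (L.chart x).symm) z)
      (ContinuousLinearMap.pi fun i => tangentMap (f i) (hy i)) (L.chart x x) :=
    hasFDerivAt_pi.2 fun i => hasFDerivAt_rep (f i) (hy i)
  have e' : tangentMap (lift f) (y := y) h =
      ContinuousLinearMap.pi fun i => tangentMap (f i) (hy i) := e.fderiv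
  rw [e']
  rfl

lemma tangentMap_pair {L : BanachManifold.{u}} (f : L ⟶ M) (g : L ⟶ N) {x : L} {y : M} {z : N}
    (hy : app f x = y) (hz : app g x = z) (h : app (pair f g) x = (y, z)) (v : L.model x) :
    tangentMap (pair f g) (y := (y, z)) h v = (tangentMap f hy v, tangentMap g hz v) := by
  have e : HasFDerivAt (fun w => ((M.chart y ∘ app f ∘ (L.chart x).symm) w,
      (N.chart z ∘ app g ∘ (L.chart x).symm) w))
      ((tangentMap f hy).prod (tangentMap g hz)) (L.chart x x) :=
    (hasFDerivAt_rep f hy).prodMk (hasFDerivAt_rep g hz)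
  have e' : tangentMap (pair f g) (y := (y, z)) h =
      (tangentMap f hy).prod (tangentMap g hz) := e.fderiv
  rw [e']
  rfl

/-! ### Submersions onto submanifolds -/

section Submersion

variable {F G H : Type u} [NormedAddCommGroup F] [NormedSpace ℝ F] [NormedAddCommGroup G]
  [NormedSpace ℝ G] [NormedAddCommGroup H] [NormedSpace ℝ H]

/-- In charts in which `f` is the projection `F × H → F × 0`, so is its tangent map. -/
lemma chartD_tangentMap_of_proj {f : M ⟶ N} {φ : OpenPartialHomeomorph M (F × H)}
    {ψ : OpenPartialHomeomorph N (F × G)} (hφ : IsSmoothChart φ) (hψ : IsSmoothChart ψ)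
    (hp : ∀ y ∈ φ.source, app f y ∈ ψ.source ∧ ψ (app f y) = ((φ y).1, 0)) {x : M}
    (hx : x ∈ φ.source) {z : N} (hz : app f x = z) (v : M.model x) :
    chartD ψ z (tangentMap f hz v) = ((chartD φ x v).1, 0) := by
  have hzψ : z ∈ ψ.source := hz ▸ (hp x hx).1
  have h1 := localD_eq hφ hψ f hz hx hzψ
  have h2 : localD φ ψ f x =
      (ContinuousLinearMap.inl ℝ F G).comp (ContinuousLinearMap.fst ℝ F H) := by
    refine HasFDerivAt.fderiv (HasFDerivAt.congr_of_eventuallyEq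
      ((ContinuousLinearMap.inl ℝ F G).comp (ContinuousLinearMap.fst ℝ F H)).hasFDerivAt ?_)
    filter_upwards [φ.open_target.mem_nhds (φ.map_source hx)] with w hw
    have := (hp _ (φ.map_target hw)).2
    rw [φ.right_inv hw] at this
    exact this
  have h3 := DFunLike.congr_fun (h1.symm.trans h2) (chartD φ x v)
  simp only [ContinuousLinearMap.comp_apply, chartDInv_chartD hφ hx] at h3
  exact h3

end Submersion

/-- A curve in `S` lifts through a submersion onto `S`, with any prescribed velocity lying over the
velocity of the curve. -/
lemma IsSurjSubmersionOnto.exists_lift {f : M ⟶ N} {S : Set N} (hf : IsSurjSubmersionOnto f S)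
    {x : M} {z : N} (hz : app f x = z) {γ : ℝ → N} {v : M.model x}
    (hγ : HasVelocity γ z (tangentMap f hz v)) (hS : ∀ᶠ t in 𝓝 0, γ t ∈ S) :
    ∃ c : ℝ → M, HasVelocity c x v ∧ ∀ᶠ t in 𝓝 0, app f (c t) = γ t := by
  obtain ⟨F, G, H, _, _, _, _, _, _, _, _, _, φ, ψ, hφ, hψ, hx, hSψ, hp⟩ := hf.2 x
  have hzψ : z ∈ ψ.source := hz ▸ (hp x hx).1
  have hψz : ψ z = ((φ x).1, 0) := by rw [← hz]; exact (hp x hx).2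
  -- in the charts, the lift has the `F`-component of the curve and an affine `H`-component
  let b : ℝ → F × H := fun t => ((ψ (γ t)).1, (φ x).2 + t • (chartD φ x v).2)
  have hb0 : b 0 = φ x := by
    refine Prod.ext ?_ ?_
    · simp [b, hγ.apply_zero, hψz]
    · simp [b]
  have hb : HasDerivAt b (chartD φ x v) 0 := by
    have h1 := hγ.chart hψ hzψ
    rw [chartD_tangentMap_of_proj hφ hψ hp hx hz] at h1
    have h2 : HasDerivAt (fun t : ℝ => (φ x).2 + t • (chartD φ x v).2) (chartD φ x v).2 0 := by
      simpa using ((hasDerivAt_id (0 : ℝ)).smul_const (chartD φ x v).2).const_add (φ x).2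
    exact (hasFDerivAt_fst.comp_hasDerivAt 0 h1).prodMk h2
  have hc := hasVelocity_symm hφ hx hb hb0
  rw [chartDInv_chartD hφ hx] at hc
  refine ⟨φ.symm ∘ b, hc, ?_⟩
  have hbt : ∀ᶠ t in 𝓝 0, b t ∈ φ.target := by
    refine hb.continuousAt (φ.open_target.mem_nhds ?_)
    rw [hb0]
    exact φ.map_source hx
  filter_upwards [hS, hbt, hγ.tendsto (ψ.open_source.mem_nhds hzψ)] with t h1 h2 h3
  have h4 := hp _ (φ.map_target h2)
  refine ψ.injOn h4.1 h3 ?_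
  refine h4.2.trans ?_
  rw [φ.right_inv h2]
  exact Prod.ext rfl ((hSψ _ h3).1 h1).symm

/-- The velocity of a curve in `S` is in the range of the tangent map of a submersion onto `S`. -/
lemma IsSurjSubmersionOnto.exists_tangentMap_eq {f : M ⟶ N} {S : Set N}
    (hf : IsSurjSubmersionOnto f S) {x : M} {z : N} (hz : app f x = z) {γ : ℝ → N}
    {w : N.model z} (hγ : HasVelocity γ z w) (hS : ∀ᶠ t in 𝓝 0, γ t ∈ S) :
    ∃ v, tangentMap f hz v = w := by
  obtain ⟨F, G, H, _, _, _, _, _, _, _, _, _, φ, ψ, hφ, hψ, hx, hSψ, hp⟩ := hf.2 x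
  have hzψ : z ∈ ψ.source := hz ▸ (hp x hx).1
  have h1 := hγ.chart hψ hzψ
  have h2 : (chartD ψ z w).2 = 0 := by
    refine (hasFDerivAt_snd.comp_hasDerivAt 0 h1).unique ?_
    refine (hasDerivAt_const (0 : ℝ) (0 : G)).congr_of_eventuallyEq ?_
    filter_upwards [hS, hγ.tendsto (ψ.open_source.mem_nhds hzψ)] with t ht1 ht2
    exact (hSψ _ ht2).1 ht1
  have h3 : ((chartD ψ z w).1, (0 : G)) = chartD ψ z w := Prod.ext rfl h2.symm
  refine ⟨chartDInv φ x ((chartD ψ z w).1, 0), ?_⟩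
  rw [← chartDInv_chartD hψ hzψ (tangentMap _ _ _), chartD_tangentMap_of_proj hφ hψ hp hx hz,
    chartD_chartDInv hφ hx, h3, chartDInv_chartD hψ hzψ w]

/-- A diffeomorphism onto `S` is a submersion onto `S`: the fibre direction is the zero space. -/
lemma IsDiffeoOnto.isSurjSubmersionOnto {f : M ⟶ N} {S : Set N} (hf : IsDiffeoOnto f S) :
    IsSurjSubmersionOnto f S := by
  refine ⟨hf.1, fun x => ?_⟩
  obtain ⟨F, G, _, _, _, _, _, _, φ, ψ, hφ, hψ, hx, hSψ, hp⟩ := hf.2.2 x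
  let e : F ≃L[ℝ] F × PUnit.{u + 1} := (ContinuousLinearEquiv.prodUnique ℝ F PUnit.{u + 1}).symm
  refine ⟨F, G, PUnit.{u + 1}, inferInstance, inferInstance, inferInstance, inferInstance,
    inferInstance, inferInstance, inferInstance, inferInstance, inferInstance,
    φ.transHomeomorph e.toHomeomorph, ψ, ?_, hψ, hx, hSψ, hp⟩
  intro y hy
  have hs := hφ y hy
  refine ⟨(e.contDiff.contDiffAt).comp _ hs.1, ?_⟩
  have h3 : e.symm (e (φ y)) = φ y := e.symm_apply_apply _
  change ContDiffAt ℝ ∞ ((M.chart y ∘ φ.symm) ∘ e.symm) (e (φ y))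
  refine ContDiffAt.comp _ ?_ e.symm.contDiff.contDiffAt
  rw [h3]
  exact hs.2

/-- A diffeomorphism onto a submanifold is an immersion. -/
lemma IsDiffeoOnto.eq_zero_of_tangentMap_eq_zero {f : M ⟶ N} {S : Set N} (hf : IsDiffeoOnto f S)
    {x : M} {z : N} (hz : app f x = z) {v : M.model x} (hv : tangentMap f hz v = 0) : v = 0 := by
  obtain ⟨F, G, _, _, _, _, _, _, φ, ψ, hφ, hψ, hx, hSψ, hp⟩ := hf.2.2 x
  have hzψ : z ∈ ψ.source := hz ▸ (hp x hx).1
  have h1 := localD_eq hφ hψ f hz hx hzψ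
  have h2 : localD φ ψ f x = ContinuousLinearMap.inl ℝ F G := by
    refine HasFDerivAt.fderiv (HasFDerivAt.congr_of_eventuallyEq
      (ContinuousLinearMap.inl ℝ F G).hasFDerivAt ?_)
    filter_upwards [φ.open_target.mem_nhds (φ.map_source hx)] with w hw
    have := (hp _ (φ.map_target hw)).2
    rw [φ.right_inv hw] at this
    exact this
  have h3 := DFunLike.congr_fun (h1.symm.trans h2) (chartD φ x v)
  simp only [ContinuousLinearMap.comp_apply, chartDInv_chartD hφ hx, hv, map_zero] at h3
  have h4 : chartD φ x v = 0 := (congrArg Prod.fst h3).symm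
  rw [← chartDInv_chartD hφ hx v, h4, map_zero]

end BanachManifold

/-! ### Tangent complexes and hypercovers -/

namespace LieNGroupoid

variable {n : ℕ} {K J : LieNGroupoid.{u} n}

/-- Cycles of the tangent complex; in degree `0` these are all tangent vectors. -/
def IsCycle : ∀ {k : ℕ} {x : K.X _⦋0⦌}, tangentFiber K.X k x → Prop := fun {k} {x} =>
  match k with
  | 0 => fun _ => True
  | k + 1 => fun v => tangentD K.X k x v = 0

lemma tangentD_eq_zero_iff {k : ℕ} {x : K.X _⦋0⦌} (v : tangentFiber K.X (k + 1) x) :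
    tangentD K.X k x v = 0 ↔ T K.X x (SimplexCategory.δ (Fin.last (k + 1))) v.1 = 0 := by
  have h : (-1 : ℝ) ^ (k + 1) ≠ 0 := pow_ne_zero _ (by norm_num)
  rw [← Subtype.coe_inj, tangentD_apply]
  exact smul_eq_zero_iff_right h

/-- A cycle of positive degree is killed by the tangent maps of all faces. -/
lemma IsCycle.T_eq_zero {k : ℕ} {x : K.X _⦋0⦌} {v : tangentFiber K.X (k + 1) x} (hv : IsCycle v)
    (i : Fin (k + 2)) : T K.X x (SimplexCategory.δ i) v.1 = 0 := by
  by_cases hi : i = Fin.last (k + 1)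
  · rw [hi]
    exact (tangentD_eq_zero_iff v).1 hv
  · exact (mem_tangentFiber_succ K.X).1 v.2 i hi

lemma IsCycle.smul {k : ℕ} {x : K.X _⦋0⦌} {v : tangentFiber K.X k x} (hv : IsCycle v) (r : ℝ) :
    IsCycle (r • v) := by
  cases k with
  | zero => trivial
  | succ k =>
    have h : tangentD K.X k x v = 0 := hv
    change tangentD K.X k x (r • v) = 0
    rw [map_smul, h, smul_zero]

lemma app_δ_pt (K : LieNGroupoid.{u} n) (k : ℕ) (i : Fin (k + 2)) (x : K.X _⦋0⦌) :
    app (K.X.δ i) (pt K.X x ⦋k + 1⦌) = pt K.X x ⦋k⦌ :=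
  map_pt K.X (SimplexCategory.δ i) x

lemma IsCycle.zero (k : ℕ) (x : K.X _⦋0⦌) : IsCycle (0 : tangentFiber K.X k x) := by
  cases k with
  | zero => trivial
  | succ k => exact map_zero (tangentD K.X k x)

lemma isCycle_tangentD {k : ℕ} {x : K.X _⦋0⦌} (v : tangentFiber K.X (k + 1) x) :
    IsCycle (tangentD K.X k x v) := by
  cases k with
  | zero => trivial
  | succ k => exact tangentD_tangentD K.X k x v

/-- The horn all of whose faces are the degenerate simplex at `x`. -/
def hornPt (K : LieNGroupoid.{u} n) (k : ℕ) (x : K.X _⦋0⦌) :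
    pi fun _ : {i : Fin (k + 2) // i ≠ Fin.last (k + 1)} => K.X _⦋k⦌ :=
  fun _ => pt K.X x ⦋k⦌

lemma app_hornMap_pt (K : LieNGroupoid.{u} n) (k : ℕ) (x : K.X _⦋0⦌) :
    app (hornMap K.X k (Fin.last (k + 1))) (pt K.X x ⦋k + 1⦌) = hornPt K k x :=
  funext fun i => app_δ_pt K k i.1 x

/-- `𝒯_{k+1}K` is the kernel of the tangent map of the last horn projection. -/
lemma tangentMap_hornMap_eq_zero {k : ℕ} {x : K.X _⦋0⦌} (v : tangentFiber K.X (k + 1) x) :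
    tangentMap (hornMap K.X k (Fin.last (k + 1))) (app_hornMap_pt K k x) v.1 = 0 := by
  refine (tangentMap_lift (fun i : {i : Fin (k + 2) // i ≠ Fin.last (k + 1)} => K.X.δ i.1)
    (y := hornPt K k x) (fun i => app_δ_pt K k i.1 x) (app_hornMap_pt K k x) v.1).trans ?_
  exact funext fun i => (mem_tangentFiber_succ K.X).1 v.2 i.1 i.2

/-- The tangent complex of a Lie `n`-groupoid vanishes in degrees greater than `n`. -/
lemma tangentFiber_eq_zero {k : ℕ} (hk : n < k + 1) {x : K.X _⦋0⦌}
    (v : tangentFiber K.X (k + 1) x) : v = 0 := by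
  apply Subtype.ext
  exact (K.horn_diffeo k (Fin.last (k + 1)) hk).eq_zero_of_tangentMap_eq_zero _
    (tangentMap_hornMap_eq_zero v)

lemma const_mem_boundarySpace (K : LieNGroupoid.{u} n) (k : ℕ) (x : K.X _⦋0⦌) :
    (fun _ => pt K.X x ⦋k⦌) ∈ boundarySpace K.X k := by
  cases k with
  | zero => trivial
  | succ k =>
    intro a b _
    rw [app_δ_pt, app_δ_pt]

lemma app_matchingMap_pt (f : K.X ⟶ J.X) (k : ℕ) (x : K.X _⦋0⦌) :
    app (matchingMap f k) (pt K.X x ⦋k + 1⦌) =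
      ((fun _ => pt K.X x ⦋k⦌ : Fin (k + 2) → K.X _⦋k⦌),
        pt J.X (app (f.app (op ⦋0⦌)) x) ⦋k + 1⦌) :=
  Prod.ext (funext fun i => app_δ_pt K k i x) (app_pt f x ⦋k + 1⦌)

lemma tangentMap_matchingMap (f : K.X ⟶ J.X) (k : ℕ) (x : K.X _⦋0⦌)
    (v : (K.X _⦋k + 1⦌).model (pt K.X x ⦋k + 1⦌)) :
    tangentMap (matchingMap f k) (app_matchingMap_pt f k x) v =
      ((fun i => T K.X x (SimplexCategory.δ i) v :
          Fin (k + 2) → (K.X _⦋k⦌).model (pt K.X x ⦋k⦌)),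
        tangentAt f x ⦋k + 1⦌ v) := by
  refine (tangentMap_pair (lift fun i => K.X.δ i) (f.app (op ⦋k + 1⦌))
    (y := fun _ => pt K.X x ⦋k⦌) (funext fun i => app_δ_pt K k i x) (app_pt f x ⦋k + 1⦌)
    (app_matchingMap_pt f k x) v).trans ?_
  refine Prod.ext ?_ rfl
  exact tangentMap_lift (fun i => K.X.δ i) (fun i => app_δ_pt K k i x) _ v

end LieNGroupoid

namespace IsHypercover

open LieNGroupoid

variable {n : ℕ} {K J : LieNGroupoid.{u} n} {f : K.X ⟶ J.X}

lemma isSurjSubmersionOnto_zero (hf : IsHypercover (K := K) (J := J) f) :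
    IsSurjSubmersionOnto (f.app (op ⦋0⦌)) Set.univ := by
  rcases Nat.eq_zero_or_pos n with h | h
  · exact (hf.zero_diffeo h).isSurjSubmersionOnto
  · exact hf.zero_submersion h

lemma isSurjSubmersionOnto_succ (hf : IsHypercover (K := K) (J := J) f) {k : ℕ} (hk : k + 1 ≤ n) :
    IsSurjSubmersionOnto (matchingMap f k) (matchingSpace f k) := by
  rcases hk.eq_or_lt with h | h
  · exact (hf.succ_diffeo k h).isSurjSubmersionOnto
  · exact hf.succ_submersion k h

/-- Let `y` be a curve of `(k + 1)`-simplices of `J` whose faces other than the last one are fixed.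
A degenerate `k`-simplex of `K` can be moved over the last face of `y`, keeping its own faces
fixed, with any prescribed velocity that is a cycle lying over the velocity of that face. With the
fixed degenerate simplices as the remaining faces, it then forms a boundary in `K` lying over the
boundary of `y`. -/
lemma exists_curve (hf : IsHypercover (K := K) (J := J) f) {k : ℕ} (hk : k ≤ n) {x : K.X _⦋0⦌}
    {v : tangentFiber K.X k x} (hv : IsCycle v) {y : ℝ → J.X _⦋k + 1⦌}
    (hy : HasVelocity (fun t => app (J.X.δ (Fin.last (k + 1))) (y t))
      (pt J.X (app (f.app (op ⦋0⦌)) x) ⦋k⦌) (tangentAt f x ⦋k⦌ v.1))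
    (hy' : ∀ᶠ t in 𝓝 0, ∀ i : Fin (k + 2), i ≠ Fin.last (k + 1) →
      app (J.X.δ i) (y t) = pt J.X (app (f.app (op ⦋0⦌)) x) ⦋k⦌) :
    ∃ c : ℝ → K.X _⦋k⦌, HasVelocity c (pt K.X x ⦋k⦌) v.1 ∧ ∀ᶠ t in 𝓝 0,
      (Function.update (fun _ : Fin (k + 2) => pt K.X x ⦋k⦌) (Fin.last (k + 1)) (c t), y t) ∈
        matchingSpace f k := by
  -- it suffices to control the image and the faces of the curve
  suffices h : ∃ c : ℝ → K.X _⦋k⦌, HasVelocity c (pt K.X x ⦋k⦌) v.1 ∧ ∀ᶠ t in 𝓝 0,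
      app (f.app (op ⦋k⦌)) (c t) = app (J.X.δ (Fin.last (k + 1))) (y t) ∧
      Function.update (fun _ : Fin (k + 2) => pt K.X x ⦋k⦌) (Fin.last (k + 1)) (c t) ∈
        boundarySpace K.X k by
    obtain ⟨c, hc, hc'⟩ := h
    refine ⟨c, hc, ?_⟩
    filter_upwards [hc', hy'] with t ht1 ht2
    refine ⟨ht1.2, fun i => ?_⟩
    by_cases hi : i = Fin.last (k + 1)
    · subst hi
      simpa using ht1.1
    · rw [ht2 i hi]
      simp only [Function.update_of_ne hi]
      exact app_pt f x ⦋k⦌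
  cases k with
  | zero =>
    obtain ⟨c, hc, hc'⟩ := hf.isSurjSubmersionOnto_zero.exists_lift (app_pt f x ⦋0⦌) hy
      (Eventually.of_forall fun _ => trivial)
    exact ⟨c, hc, hc'.mono fun t ht => ⟨ht, trivial⟩⟩
  | succ k =>
    have h1 : HasVelocity (M := prod (pi fun _ : Fin (k + 2) => K.X _⦋k⦌) (J.X _⦋k + 1⦌))
        (fun t => (fun _ => pt K.X x ⦋k⦌, app (J.X.δ (Fin.last (k + 2))) (y t))) _
        (tangentMap (matchingMap f k) (app_matchingMap_pt f k x) v.1) := by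
      rw [tangentMap_matchingMap]
      refine HasVelocity.prodMk (HasVelocity.pi fun i => ?_) hy
      rw [hv.T_eq_zero i]
      exact HasVelocity.const _
    obtain ⟨c, hc, hc'⟩ := (hf.isSurjSubmersionOnto_succ hk).exists_lift _ h1 (by
      filter_upwards [hy'] with t ht
      refine ⟨const_mem_boundarySpace K k x, fun i => ?_⟩
      have h2 := congrArg (fun g => app g (y t)) (J.X.δ_comp_δ (Fin.le_last i))
      rw [Fin.succ_last] at h2
      refine (app_pt f x ⦋k⦌).trans (Eq.trans ?_ h2.symm)
      rw [app_comp, ht _ (Fin.castSucc_ne_last i), app_δ_pt])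
    refine ⟨c, hc, hc'.mono fun t ht => ⟨congrArg Prod.snd ht, fun a b hab => ?_⟩⟩
    have h3 : ∀ i, app (K.X.δ i) (c t) = pt K.X x ⦋k⦌ := congrFun (congrArg Prod.fst ht)
    rw [Function.update_of_ne (Fin.castSucc_ne_last a), app_δ_pt]
    by_cases hb : b.succ = Fin.last (k + 2)
    · rw [hb, Function.update_self, h3]
    · rw [Function.update_of_ne hb, app_δ_pt]

/-- The linear lifting property in degrees at most `n`, without the sign of the differential. The
pair `((0, …, 0, v), w)` is the velocity of a curve in the fibre product onto which the matching
map is a submersion, hence in the range of the tangent map of the latter. -/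
lemma exists_tangent_lift_of_le (hf : IsHypercover (K := K) (J := J) f) {k : ℕ} (hk : k + 1 ≤ n)
    {x : K.X _⦋0⦌} {v : tangentFiber K.X k x} (hv : IsCycle v)
    {w : tangentFiber J.X (k + 1) (app (f.app (op ⦋0⦌)) x)}
    (hw : T J.X _ (SimplexCategory.δ (Fin.last (k + 1))) w.1 = tangentAt f x ⦋k⦌ v.1) :
    ∃ u : tangentFiber K.X (k + 1) x, T K.X x (SimplexCategory.δ (Fin.last (k + 1))) u.1 = v.1 ∧
      tangentAt f x ⦋k + 1⦌ u.1 = w.1 := by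
  -- a curve with velocity `w` whose faces other than the last one are fixed
  have hp := app_hornMap_pt J k (app (f.app (op ⦋0⦌)) x)
  obtain ⟨y, hy, hy'⟩ := (J.horn_submersion k (Fin.last (k + 1))).exists_lift hp (v := w.1)
    (γ := fun _ => hornPt J k (app (f.app (op ⦋0⦌)) x)) (by
      rw [tangentMap_hornMap_eq_zero]
      exact HasVelocity.const _) (Eventually.of_forall fun _ => by
      rw [← (J.horn_submersion k (Fin.last (k + 1))).1]
      exact ⟨_, hp⟩)
  have hd := hy.map (J.X.δ (Fin.last (k + 1))) (app_δ_pt J k _ _)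
  have hd' : HasVelocity (fun t => app (J.X.δ (Fin.last (k + 1))) (y t))
      (pt J.X (app (f.app (op ⦋0⦌)) x) ⦋k⦌) (tangentAt f x ⦋k⦌ v.1) := hw ▸ hd
  obtain ⟨c, hc, hc'⟩ := hf.exists_curve (k.le_succ.trans hk) hv hd'
    (hy'.mono fun t ht i hi => congrFun ht ⟨i, hi⟩)
  have hz : HasVelocity (M := prod (pi fun _ : Fin (k + 2) => K.X _⦋k⦌) (J.X _⦋k + 1⦌))
      (fun t => (Function.update (fun _ : Fin (k + 2) => pt K.X x ⦋k⦌) (Fin.last (k + 1)) (c t),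
        y t)) ((fun _ => pt K.X x ⦋k⦌ : Fin (k + 2) → K.X _⦋k⦌), _)
      ((Function.update (fun _ => 0) (Fin.last (k + 1)) v.1 :
        Fin (k + 2) → (K.X _⦋k⦌).model (pt K.X x ⦋k⦌)), w.1) := by
    refine HasVelocity.prodMk (HasVelocity.pi fun i => ?_) hy
    by_cases hi : i = Fin.last (k + 1)
    · subst hi
      simpa using hc
    · simp only [Function.update_of_ne hi]
      exact HasVelocity.const _
  obtain ⟨u, hu⟩ := (hf.isSurjSubmersionOnto_succ hk).exists_tangentMap_eq
    (app_matchingMap_pt f k x) hz hc'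
  rw [tangentMap_matchingMap] at hu
  have hu1 : (fun i => T K.X x (SimplexCategory.δ i) u) =
      Function.update (fun _ => 0) (Fin.last (k + 1)) v.1 := congrArg Prod.fst hu
  refine ⟨⟨u, (mem_tangentFiber_succ K.X).2 fun i hi => ?_⟩, ?_, congrArg Prod.snd hu⟩
  · exact (congrFun hu1 i).trans (Function.update_of_ne hi _ _)
  · exact (congrFun hu1 _).trans (Function.update_self _ _ _)

/-- In degrees at least `n`, a cycle in the kernel of `Tf` vanishes. -/
lemma eq_zero_of_isCycle (hf : IsHypercover (K := K) (J := J) f) {k : ℕ} (hk : n ≤ k)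
    {x : K.X _⦋0⦌} {v : tangentFiber K.X k x} (hv : IsCycle v) (h : tangentAt f x ⦋k⦌ v.1 = 0) :
    v = 0 := by
  rcases hk.eq_or_lt with hk | hk
  · apply Subtype.ext
    cases k with
    | zero => exact (hf.zero_diffeo hk).eq_zero_of_tangentMap_eq_zero _ h
    | succ k =>
      refine (hf.succ_diffeo k hk.symm).eq_zero_of_tangentMap_eq_zero
        (app_matchingMap_pt f k x) ?_
      rw [tangentMap_matchingMap]
      exact Prod.ext (funext hv.T_eq_zero) h
  · obtain ⟨k, rfl⟩ := Nat.exists_eq_add_one_of_ne_zero (Nat.ne_zero_of_lt hk)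
    exact tangentFiber_eq_zero hk v

/-- The linear lifting property: a cycle `v` and an element `w` of `𝒯J` with `∂w = Tf v` come from
an element `u` of `𝒯K` with `∂u = v` and `Tf u = w`. -/
theorem exists_tangent_lift (hf : IsHypercover (K := K) (J := J) f) {k : ℕ} {x : K.X _⦋0⦌}
    {v : tangentFiber K.X k x} (hv : IsCycle v)
    {w : tangentFiber J.X (k + 1) (app (f.app (op ⦋0⦌)) x)}
    (hw : tangentD J.X k _ w = (tangentHom f).map k x v) :
    ∃ u : tangentFiber K.X (k + 1) x, tangentD K.X k x u = v ∧
      (tangentHom f).map (k + 1) x u = w := by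
  have hw1 : (-1 : ℝ) ^ (k + 1) • T J.X _ (SimplexCategory.δ (Fin.last (k + 1))) w.1 =
      tangentAt f x ⦋k⦌ v.1 := congrArg Subtype.val hw
  rcases Nat.lt_or_ge k n with hk | hk
  · have hε : (-1 : ℝ) ^ (k + 1) * (-1 : ℝ) ^ (k + 1) = 1 := by
      rw [← mul_pow]
      norm_num
    obtain ⟨u, hu1, hu2⟩ := hf.exists_tangent_lift_of_le hk (hv.smul ((-1 : ℝ) ^ (k + 1))) (w := w)
      (by
        change _ = tangentAt f x ⦋k⦌ ((-1 : ℝ) ^ (k + 1) • v.1)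
        rw [map_smul, ← hw1, smul_smul, hε, one_smul])
    refine ⟨u, Subtype.ext ?_, Subtype.ext hu2⟩
    rw [tangentD_apply, hu1]
    change (-1 : ℝ) ^ (k + 1) • (-1 : ℝ) ^ (k + 1) • v.1 = v.1
    rw [smul_smul, hε, one_smul]
  · obtain rfl := tangentFiber_eq_zero (Nat.lt_succ_of_le hk) w
    have hv0 : v = 0 := hf.eq_zero_of_isCycle hk hv (by simpa using hw1.symm)
    exact ⟨0, by rw [hv0, map_zero], map_zero _⟩

/-- Every cycle lifts to a cycle. -/
lemma exists_isCycle_lift (hf : IsHypercover (K := K) (J := J) f) {k : ℕ} {x : K.X _⦋0⦌}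
    {w : tangentFiber J.X k (app (f.app (op ⦋0⦌)) x)} (hw : IsCycle w) :
    ∃ v : tangentFiber K.X k x, IsCycle v ∧ (tangentHom f).map k x v = w := by
  cases k with
  | zero =>
    obtain ⟨c, hc⟩ := exists_hasVelocity w.1
    obtain ⟨v, hv⟩ := hf.isSurjSubmersionOnto_zero.exists_tangentMap_eq (app_pt f x ⦋0⦌) hc
      (Eventually.of_forall fun _ => trivial)
    exact ⟨⟨v, trivial⟩, trivial, Subtype.ext hv⟩
  | succ k =>
    obtain ⟨u, hu1, hu2⟩ := hf.exists_tangent_lift (k := k) (x := x) (v := 0)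
      (IsCycle.zero k x) (w := w)
      (hw.trans (map_zero ((tangentHom f).map k x)).symm)
    exact ⟨u, hu1, hu2⟩

lemma surjective_tangentHom (hf : IsHypercover (K := K) (J := J) f) (l : ℕ) (x : K.X _⦋0⦌) :
    Function.Surjective ((tangentHom f).map l x) := by
  intro w
  cases l with
  | zero =>
    obtain ⟨v, -, hv⟩ := hf.exists_isCycle_lift (k := 0) (w := w) trivial
    exact ⟨v, hv⟩
  | succ l =>
    obtain ⟨v, hv, hv'⟩ := hf.exists_isCycle_lift (isCycle_tangentD w)
    obtain ⟨u, -, hu⟩ := hf.exists_tangent_lift hv hv'.symm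
    exact ⟨u, hu⟩

end IsHypercover

/-! ### Quasi-isomorphisms of complexes of vector spaces -/

namespace CategoryTheory.ShortComplex

variable {R : Type*} [Ring R] {S₁ S₂ : ShortComplex (ModuleCat.{u} R)}

/-- A cycle is a boundary if and only if its homology class vanishes. -/
lemma moduleCat_homologyπ_eq_zero_iff (S : ShortComplex (ModuleCat.{u} R)) (z : S.cycles) :
    S.homologyπ z = 0 ↔ ∃ y, S.f y = S.iCycles z := by
  constructor
  · intro h
    have h1 := (ShortComplex.moduleCat_exact_iff
      (ShortComplex.mk S.toCycles S.homologyπ S.toCycles_comp_homologyπ)).1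
      (ShortComplex.exact_of_g_is_cokernel _ S.homologyIsCokernel) z h
    obtain ⟨y, hy⟩ := h1
    refine ⟨y, ?_⟩
    rw [← hy, ← S.toCycles_i]
    rfl
  · rintro ⟨y, hy⟩
    have h1 : S.toCycles y = z := by
      refine (ModuleCat.mono_iff_injective S.iCycles).1 inferInstance ?_
      rw [← hy, ← S.toCycles_i]
      rfl
    rw [← h1, ← ConcreteCategory.comp_apply, S.toCycles_comp_homologyπ]
    rfl

lemma moduleCat_exists_iCycles_eq (S : ShortComplex (ModuleCat.{u} R)) {y : S.X₂} (hy : S.g y = 0) :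
    ∃ z : S.cycles, S.iCycles z = y := by
  have h1 := (ShortComplex.moduleCat_exact_iff
    (ShortComplex.mk S.iCycles S.g S.iCycles_g)).1
    (ShortComplex.exact_of_f_is_kernel _ S.cyclesIsKernel) y hy
  exact h1

lemma moduleCat_g_iCycles (S : ShortComplex (ModuleCat.{u} R)) (z : S.cycles) :
    S.g (S.iCycles z) = 0 := by
  rw [← ConcreteCategory.comp_apply, S.iCycles_g]
  rfl

/-- A morphism which lifts cycles to cycles, and reflects boundaries among cycles, is a
quasi-isomorphism. -/
lemma moduleCat_quasiIso_of_lift (φ : S₁ ⟶ S₂) (h : ∀ y, S₂.g y = 0 → ∃ x, S₁.g x = 0 ∧ φ.τ₂ x = y)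
    (h' : ∀ x, S₁.g x = 0 → ∀ y, S₂.f y = φ.τ₂ x → ∃ z, S₁.f z = x) :
    ShortComplex.QuasiIso φ := by
  have nat : ∀ z, ShortComplex.homologyMap φ (S₁.homologyπ z) =
      S₂.homologyπ (ShortComplex.cyclesMap φ z) := fun z => by
    rw [← ConcreteCategory.comp_apply, ShortComplex.homologyπ_naturality]
    rfl
  have nat' : ∀ z, S₂.iCycles (ShortComplex.cyclesMap φ z) = φ.τ₂ (S₁.iCycles z) := fun z => by
    rw [← ConcreteCategory.comp_apply, ShortComplex.cyclesMap_i]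
    rfl
  have surj₁ := (ModuleCat.epi_iff_surjective S₁.homologyπ).1 inferInstance
  have surj₂ := (ModuleCat.epi_iff_surjective S₂.homologyπ).1 inferInstance
  have inj₂ := (ModuleCat.mono_iff_injective S₂.iCycles).1 inferInstance
  rw [ShortComplex.quasiIso_iff, ConcreteCategory.isIso_iff_bijective]
  constructor
  · rw [injective_iff_map_eq_zero]
    intro a ha
    obtain ⟨z, rfl⟩ := surj₁ a
    rw [nat, moduleCat_homologyπ_eq_zero_iff] at ha
    obtain ⟨y, hy⟩ := ha
    rw [nat'] at hy
    exact (moduleCat_homologyπ_eq_zero_iff S₁ z).2 (h' _ (moduleCat_g_iCycles S₁ z) y hy)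
  · intro b
    obtain ⟨z, rfl⟩ := surj₂ b
    obtain ⟨x, hx, hxz⟩ := h _ (moduleCat_g_iCycles S₂ z)
    obtain ⟨z', rfl⟩ := moduleCat_exists_iCycles_eq S₁ hx
    refine ⟨S₁.homologyπ z', ?_⟩
    rw [nat]
    congr 1
    exact inj₂ ((nat' z').trans hxz)

end CategoryTheory.ShortComplex

lemma BundleComplex.fiberComplex_d {M : BanachManifold.{u}} (A : BundleComplex M) (x : M) (l : ℕ)
    (v : (A.bundle (l + 1)).fiber x) : (A.fiberComplex x).d (l + 1) l v = A.d l x v :=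
  congrArg (fun g => g.hom v)
    (ChainComplex.of_d (fun l => ModuleCat.of ℝ ((A.bundle l).fiber x))
      (fun l => ModuleCat.ofHom (A.d l x).toLinearMap) l)

namespace IsHypercover

open LieNGroupoid

variable {n : ℕ} {K J : LieNGroupoid.{u} n} {f : K.X ⟶ J.X}

lemma quasiIso_fiberMap (hf : IsHypercover (K := K) (J := J) f) (x : K.X _⦋0⦌) :
    QuasiIso ((tangentHom f).fiberMap x) := by
  have hd : ∀ (K : LieNGroupoid.{u} n) (x : K.X _⦋0⦌) (k : ℕ) (v : tangentFiber K.X k x),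
      IsCycle v ↔ (K.tangentComplex.fiberComplex x).d k ((ComplexShape.down ℕ).next k) v = 0 := by
    intro K x k v
    cases k with
    | zero =>
      rw [HomologicalComplex.shape _ _ _ (by simp)]
      exact ⟨fun _ => rfl, fun _ => trivial⟩
    | succ k =>
      rw [ChainComplex.next_nat_succ]
      exact (Eq.congr_left (K.tangentComplex.fiberComplex_d x k v)).symm
  refine ⟨fun k => ?_⟩
  rw [quasiIsoAt_iff' _ (k + 1) k _ (by simp) rfl]
  refine ShortComplex.moduleCat_quasiIso_of_lift _ (fun w hw => ?_) (fun v hv w hw => ?_)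
  · obtain ⟨v, hv, hvw⟩ := hf.exists_isCycle_lift ((hd J _ k w).2 hw)
    exact ⟨v, (hd K x k v).1 hv, hvw⟩
  · obtain ⟨u, hu, -⟩ := hf.exists_tangent_lift ((hd K x k v).2 hv) (w := w)
      ((J.tangentComplex.fiberComplex_d _ k w).symm.trans hw)
    exact ⟨u, (K.tangentComplex.fiberComplex_d x k u).trans hu⟩

/-- A hypercover induces a quasi-isomorphism of tangent complexes. -/
theorem isQuasiIso_tangentHom (hf : IsHypercover (K := K) (J := J) f) :
    (tangentHom f).IsQuasiIso :=
  ⟨hf.isSurjSubmersionOnto_zero, hf.quasiIso_fiberMap⟩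

end IsHypercover

/-! ### Pullbacks of alternating maps and of differential forms -/

section Alternating

variable {E E' G : Type*} [NormedAddCommGroup E] [NormedSpace ℝ E] [NormedAddCommGroup E']
  [NormedSpace ℝ E'] [NormedAddCommGroup G] [NormedSpace ℝ G] {q : ℕ}

/-- Alternatization of continuous multilinear maps as a continuous linear map, normalised so as to
be the identity on alternating maps. -/
def ContinuousMultilinearMap.alternatizationCLM (E : Type*) [NormedAddCommGroup E]
    [NormedSpace ℝ E] (q : ℕ) :
    ContinuousMultilinearMap ℝ (fun _ : Fin q => E) ℝ →L[ℝ] E [⋀^Fin q]→L[ℝ] ℝ :=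
  (q.factorial : ℝ)⁻¹ • LinearMap.mkContinuous
    { toFun := fun f => ContinuousMultilinearMap.alternatization f
      map_add' := map_add _
      map_smul' := fun r f => by
        ext v
        simp [ContinuousMultilinearMap.alternatization_apply_apply, Finset.mul_sum,
          mul_left_comm, Units.smul_def] }
    (q.factorial : ℝ) (fun f => by
      refine ContinuousAlternatingMap.opNorm_le_bound _ (by positivity) fun v => ?_
      refine (congrArg norm
        (ContinuousMultilinearMap.alternatization_apply_apply f v)).le.trans ?_
      refine (norm_sum_le_of_le _ (f := fun σ : Equiv.Perm (Fin q) =>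
        Equiv.Perm.sign σ • f (v ∘ σ)) (n := fun _ => ‖f‖ * ∏ i, ‖v i‖) fun σ _ => ?_).trans ?_
      · have h1 : ‖Equiv.Perm.sign σ • f (v ∘ σ)‖ = ‖f (v ∘ σ)‖ := by
          rcases Int.units_eq_one_or (Equiv.Perm.sign σ) with h | h <;> simp [h]
        rw [h1]
        refine (f.le_opNorm _).trans_eq ?_
        rw [← Equiv.prod_comp σ fun i => ‖v i‖]
        rfl
      · simp [Finset.card_univ, Fintype.card_perm, mul_assoc])

lemma ContinuousMultilinearMap.alternatizationCLM_apply (η : E [⋀^Fin q]→L[ℝ] ℝ) :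
    ContinuousMultilinearMap.alternatizationCLM E q η.toContinuousMultilinearMap = η := by
  ext v
  have h : ∀ σ : Equiv.Perm (Fin q), Equiv.Perm.sign σ • η (v ∘ σ) = η v := by
    intro σ
    have := η.toAlternatingMap.map_perm v σ
    have h2 : η (v ∘ σ) = Equiv.Perm.sign σ • η v := this
    rw [h2, smul_smul, Int.units_mul_self, one_smul]
  have h3 : (q.factorial : ℝ) ≠ 0 := by positivity
  change (q.factorial : ℝ)⁻¹ • ContinuousMultilinearMap.alternatization
    η.toContinuousMultilinearMap v = η v
  rw [ContinuousMultilinearMap.alternatization_apply_apply]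
  refine (congrArg _ (Finset.sum_congr rfl fun σ _ => h σ)).trans ?_
  simp [Finset.card_univ, Fintype.card_perm, h3]

/-- The pullback of alternating maps is smooth as a function of the alternating map and of the
linear map: it is linear in the former and polynomial in the latter. -/
lemma ContDiffAt.continuousAlternatingMapCompContinuousLinearMap {r : WithTop ℕ∞}
    {η : G → E' [⋀^Fin q]→L[ℝ] ℝ} {g : G → E →L[ℝ] E'} {z : G}
    (hη : ContDiffAt ℝ r η z) (hg : ContDiffAt ℝ r g z) :
    ContDiffAt ℝ r (fun w => (η w).compContinuousLinearMap (g w)) z := by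
  have h1 : ContDiffAt ℝ r (fun w =>
      ContinuousMultilinearMap.compContinuousLinearMapContinuousMultilinear ℝ
        (fun _ : Fin q => E) (fun _ : Fin q => E') ℝ (fun _ => g w)) z :=
    (ContinuousMultilinearMap.contDiff _).contDiffAt.comp z (contDiffAt_pi.2 fun _ => hg)
  have h2 : ContDiffAt ℝ r (fun w =>
      ContinuousAlternatingMap.toContinuousMultilinearMapCLM ℝ (η w)) z :=
    (ContinuousLinearMap.contDiff _).contDiffAt.comp z hη
  have h3 := (ContinuousMultilinearMap.alternatizationCLM E q).contDiff.contDiffAt.comp z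
    (h1.clm_apply h2)
  refine h3.congr_of_eventuallyEq (Eventually.of_forall fun w => ?_)
  exact (ContinuousMultilinearMap.alternatizationCLM_apply
    ((η w).compContinuousLinearMap (g w))).symm

end Alternating

namespace Form

variable {M N P : BanachManifold.{u}} {q : ℕ}

lemma pullback_apply (f : M ⟶ N) (η : Form N q) {x : M} {y : N} (h : app f x = y) :
    pullback f η x = (η y).compContinuousLinearMap (tangentMap f h) := by
  subst h
  rfl

lemma pullback_comp (f : M ⟶ N) (g : N ⟶ P) (η : Form P q) :
    pullback (f ≫ g) η = pullback f (pullback g η) := by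
  funext x
  rw [pullback_apply f _ rfl, pullback_apply g η rfl,
    pullback_apply (f ≫ g) η (y := app g (app f x)) rfl,
    tangentMap_comp f g rfl rfl rfl]
  rfl

lemma pullback_smul (f : M ⟶ N) (r : ℝ) (η : Form N q) :
    pullback f (r • η) = r • pullback f η := rfl

lemma pullback_sum {ι : Type*} (s : Finset ι) (f : M ⟶ N) (η : ι → Form N q) :
    pullback f (∑ i ∈ s, η i) = ∑ i ∈ s, pullback f (η i) :=
  map_sum ({ toFun := pullback f, map_zero' := rfl, map_add' := fun _ _ => rfl } :
    Form N q →+ Form M q) η s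

/-- The expression of `f^* η` in a chart is the pullback of the expression of `η` along the
expression of `f`. -/
lemma rep_pullback (f : M ⟶ N) (η : Form N q) (x : M) (b : N) {z : M.model x}
    (hz : z ∈ (M.chart x).target)
    (hb : app f ((M.chart x).symm z) ∈ (N.chart b).source) :
    (pullback f η).rep x z =
      (η.rep b ((N.chart b ∘ app f ∘ (M.chart x).symm) z)).compContinuousLinearMap
        (fderiv ℝ (N.chart b ∘ app f ∘ (M.chart x).symm) z) := by
  have hy : (M.chart x).symm z ∈ (M.chart x).source := (M.chart x).map_target hz
  have hq : app f ((M.chart x).symm z) =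
      (N.chart b).symm ((N.chart b ∘ app f ∘ (M.chart x).symm) z) :=
    ((N.chart b).left_inv hb).symm
  have hqs : (N.chart b).symm ((N.chart b ∘ app f ∘ (M.chart x).symm) z) ∈
      (N.chart b).source := hq ▸ hb
  have h1 := localD_eq (isSmoothChart_chart x) (isSmoothChart_chart b) f hq hy hqs
  rw [localD, (M.chart x).right_inv hz] at h1
  rw [rep, pullback_apply f η hq, h1, rep]
  ext v
  simp only [ContinuousAlternatingMap.compContinuousLinearMap_apply]
  congr 1
  funext i
  simp only [Function.comp_apply, ContinuousLinearMap.comp_apply]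
  exact (chartDInv_chartD (isSmoothChart_chart b) hqs _).symm

lemma rep_pullback_eventuallyEq (f : M ⟶ N) (η : Form N q) (x : M) (b : N) {z : M.model x}
    (hz : z ∈ (M.chart x).target)
    (hb : app f ((M.chart x).symm z) ∈ (N.chart b).source) :
    (pullback f η).rep x =ᶠ[𝓝 z] fun w =>
      (η.rep b ((N.chart b ∘ app f ∘ (M.chart x).symm) w)).compContinuousLinearMap
        (fderiv ℝ (N.chart b ∘ app f ∘ (M.chart x).symm) w) := by
  have h : ContinuousAt (app f ∘ (M.chart x).symm) z :=
    (SmoothMap.continuous_toFun f).continuousAt.comp ((M.chart x).continuousAt_symm hz)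
  filter_upwards [(M.chart x).open_target.mem_nhds hz,
    h ((N.chart b).open_source.mem_nhds hb)] with w hw1 hw2
  exact rep_pullback f η x b hw1 hw2

lemma contDiffAt_localRep (f : M ⟶ N) (x : M) (b : N) {z : M.model x}
    (hz : z ∈ (M.chart x).target)
    (hb : app f ((M.chart x).symm z) ∈ (N.chart b).source) :
    ContDiffAt ℝ ∞ (N.chart b ∘ app f ∘ (M.chart x).symm) z := by
  have := localRep_contDiffAt (isSmoothChart_chart x) (isSmoothChart_chart b) f
    ((M.chart x).map_target hz) hb
  rwa [(M.chart x).right_inv hz] at this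

lemma IsSmooth.contDiffAt {η : Form N q} (hη : η.IsSmooth) {b : N} {z : N.model b}
    (hz : z ∈ (N.chart b).target) : ContDiffAt ℝ ∞ (η.rep b) z :=
  (hη b).contDiffAt ((N.chart b).open_target.mem_nhds hz)

lemma IsSmooth.pullback {η : Form N q} (hη : η.IsSmooth) (f : M ⟶ N) :
    (pullback f η).IsSmooth := by
  intro x z hz
  have hb := N.mem_chart (app f ((M.chart x).symm z))
  have h := contDiffAt_localRep f x _ hz hb
  refine ContDiffAt.contDiffWithinAt (ContDiffAt.congr_of_eventuallyEq ?_
    (rep_pullback_eventuallyEq f η x _ hz hb))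
  refine ContDiffAt.continuousAlternatingMapCompContinuousLinearMap
    (ContDiffAt.comp (g := η.rep _) z (hη.contDiffAt ((N.chart _).map_source hb)) h)
    (h.fderiv_right (by simp))

lemma deRham_pullback (f : M ⟶ N) {η : Form N q} (hη : η.IsSmooth) :
    deRham (pullback f η) = pullback f (deRham η) := by
  funext x
  have hz := (M.chart x).map_source (M.mem_chart x)
  have hx : app f ((M.chart x).symm (M.chart x x)) = app f x := by
    rw [(M.chart x).left_inv (M.mem_chart x)]
  have hb : app f ((M.chart x).symm (M.chart x x)) ∈ (N.chart (app f x)).source := by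
    rw [hx]
    exact N.mem_chart _
  have e : (N.chart (app f x) ∘ app f ∘ (M.chart x).symm) (M.chart x x) =
      N.chart (app f x) (app f x) := rep_apply f x
  rw [deRham, (rep_pullback_eventuallyEq f η x (app f x) hz hb).extDeriv_eq,
    extDeriv_pullback (r := 2) ?_ ((contDiffAt_localRep f x _ hz hb).of_le
      (WithTop.coe_le_coe.2 le_top))
      (by simp), e]
  · rfl
  · rw [e]
    exact (hη.contDiffAt ((N.chart _).map_source (N.mem_chart _))).differentiableAt (by simp)

end Form

namespace SimplicialManifold.BiForm

variable {X Y : SimplicialManifold.{u}}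

lemma simplicialD_pullback (f : Y ⟶ X) (α : BiForm X) :
    (pullback f α).simplicialD = pullback f α.simplicialD := by
  funext p q
  cases p with
  | zero => rfl
  | succ p =>
    change ∑ i : Fin (p + 2), (-1 : ℝ) ^ (i : ℕ) • Form.pullback (Y.δ i)
        (Form.pullback (f.app (op ⦋p⦌)) (α p q)) =
      Form.pullback (f.app (op ⦋p + 1⦌))
        (∑ i : Fin (p + 2), (-1 : ℝ) ^ (i : ℕ) • Form.pullback (X.δ i) (α p q))
    rw [Form.pullback_sum]
    refine Finset.sum_congr rfl fun i _ => ?_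
    rw [Form.pullback_smul, ← Form.pullback_comp, ← Form.pullback_comp]
    congr 2
    exact (f.naturality (SimplexCategory.δ i).op)

lemma deRham_pullback (f : Y ⟶ X) {α : BiForm X} (hα : ∀ p q, (α p q).IsSmooth) :
    (pullback f α).deRham = pullback f α.deRham := by
  funext p q
  cases q with
  | zero => rfl
  | succ q => exact Form.deRham_pullback _ (hα p q)

lemma IsClosed.pullback {α : BiForm X} (h : α.IsClosed) (hα : ∀ p q, (α p q).IsSmooth)
    (f : Y ⟶ X) : (pullback f α).IsClosed := by
  intro p q
  rw [totalD, simplicialD_pullback, deRham_pullback f hα]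
  exact congrArg (Form.pullback (f.app (op ⦋p⦌))) (h p q)

lemma IsShiftedForm.pullback {m k : ℕ} {α : BiForm X} (h : α.IsShiftedForm m k) (f : Y ⟶ X) :
    (pullback f α).IsShiftedForm m k := by
  refine ⟨fun p q => (h.1 p q).pullback _, fun p q hpq => ?_, fun p q i => ?_⟩
  · exact congrArg (Form.pullback (f.app (op ⦋p⦌))) (h.2.1 p q hpq)
  · have e : Y.σ i ≫ f.app (op ⦋p + 1⦌) = f.app (op ⦋p⦌) ≫ X.σ i :=
      f.naturality (SimplexCategory.σ i).op
    change Form.pullback (Y.σ i) (Form.pullback (f.app (op ⦋p + 1⦌)) (α (p + 1) q)) = 0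
    rw [← Form.pullback_comp, e, Form.pullback_comp, h.2.2 p q i]
    rfl

end SimplicialManifold.BiForm

/-! ### Non-degeneracy -/

namespace LieNGroupoid

variable {n : ℕ} {K J : LieNGroupoid.{u} n}

/-- The pairing `λ` is natural. -/
lemma imPairing_pullback (f : J.X ⟶ K.X) (α : BiForm K.X) {m l r : ℕ} (h : l + r = m)
    (x : J.X _⦋0⦌) (v : tangentFiber J.X l x) (w : tangentFiber J.X r x) :
    imPairing h (BiForm.pullback f α) x v w =
      imPairing h α (app (f.app (op ⦋0⦌)) x) ((tangentHom f).map l x v)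
        ((tangentHom f).map r x w) := by
  refine Finset.sum_congr rfl fun σ _ => ?_
  split_ifs
  · congr 1
    have h1 : BiForm.pullback f α m 2 (pt J.X x ⦋m⦌) =
        (α m 2 (pt K.X _ ⦋m⦌)).compContinuousLinearMap
        (tangentAt f x ⦋m⦌) := Form.pullback_apply (f.app (op ⦋m⦌)) (α m 2) (app_pt f x ⦋m⦌)
    rw [h1, ContinuousAlternatingMap.compContinuousLinearMap_apply]
    congr 1
    funext i
    fin_cases i
    · exact tangentAt_T f x _ _
    · exact tangentAt_T f x _ _
  · rfl

/-- The map induced by a simplicial map on the cycles of the tangent complexes. -/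
def cyclesMap (f : J.X ⟶ K.X) (x : J.X _⦋0⦌) (l : ℕ) (v : J.cyclesAt x l) :
    K.cyclesAt (app (f.app (op ⦋0⦌)) x) l :=
  (HomologicalComplex.cyclesMap ((tangentHom f).fiberMap x) l).hom v

lemma cycleVal_cyclesMap (f : J.X ⟶ K.X) (x : J.X _⦋0⦌) (l : ℕ) (v : J.cyclesAt x l) :
    K.cycleVal _ l (cyclesMap f x l v) = (tangentHom f).map l x (J.cycleVal x l v) :=
  congrArg (fun g => g.hom v) (HomologicalComplex.cyclesMap_i ((tangentHom f).fiberMap x) l)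

end LieNGroupoid

namespace IsHypercover

open LieNGroupoid

variable {n : ℕ} {K J : LieNGroupoid.{u} n} {f : J.X ⟶ K.X}

/-- The isomorphism induced by a hypercover on the homology of the tangent complexes. -/
def homologyEquiv (hf : IsHypercover (K := J) (J := K) f) (x : J.X _⦋0⦌) (l : ℕ) :
    J.homologyAt x l ≃ₗ[ℝ] K.homologyAt (app (f.app (op ⦋0⦌)) x) l :=
  haveI := hf.quasiIso_fiberMap x
  (asIso (HomologicalComplex.homologyMap ((tangentHom f).fiberMap x) l)).toLinearEquiv

lemma homologyEquiv_cycleClass (hf : IsHypercover (K := J) (J := K) f) (x : J.X _⦋0⦌) (l : ℕ)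
    (v : J.cyclesAt x l) :
    hf.homologyEquiv x l (J.cycleClass x l v) = K.cycleClass _ l (cyclesMap f x l v) :=
  congrArg (fun g => g.hom v)
    (HomologicalComplex.homologyπ_naturality ((tangentHom f).fiberMap x) l)

lemma isNondegenerate_pullback (hf : IsHypercover (K := J) (J := K) f) {m : ℕ} {α : BiForm K.X}
    (h : K.IsNondegenerate m α) : J.IsNondegenerate m (BiForm.pullback f α) := by
  intro x
  obtain ⟨h1, h2⟩ := h (app (f.app (op ⦋0⦌)) x)
  refine ⟨fun l r hlr => ?_, fun l hl => ?_⟩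
  · obtain ⟨B, hB, hB'⟩ := h1 l r hlr
    refine ⟨B.compl₁₂ (hf.homologyEquiv x l).toLinearMap (hf.homologyEquiv x r).toLinearMap,
      fun v w => ?_, ?_⟩
    · have h3 := hB (cyclesMap f x l v) (cyclesMap f x r w)
      rw [← hf.homologyEquiv_cycleClass, ← hf.homologyEquiv_cycleClass, cycleVal_cyclesMap,
        cycleVal_cyclesMap] at h3
      exact h3.trans (imPairing_pullback f α hlr x _ _).symm
    · constructor
      · intro a ha
        refine (hf.homologyEquiv x l).map_eq_zero_iff.1 (hB'.1 _ fun b => ?_)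
        obtain ⟨b, rfl⟩ := (hf.homologyEquiv x r).surjective b
        exact ha b
      · intro b hb
        refine (hf.homologyEquiv x r).map_eq_zero_iff.1 (hB'.2 _ fun a => ?_)
        obtain ⟨a, rfl⟩ := (hf.homologyEquiv x l).surjective a
        exact hb a
  · have := h2 l hl
    exact (hf.homologyEquiv x l).toEquiv.subsingleton

theorem isShiftedSymplectic_pullback (hf : IsHypercover (K := J) (J := K) f) {m : ℕ}
    {α : BiForm K.X} (h : K.IsShiftedSymplectic m α) :
    J.IsShiftedSymplectic m (BiForm.pullback f α) :=
  ⟨h.1.pullback f, h.2.1.pullback h.1.1 f, hf.isNondegenerate_pullback h.2.2⟩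

end IsHypercover

end

theorem mainTheorem9 (n : ℕ) :
    (∀ (K J : LieNGroupoid.{u} n) (f : K.X ⟶ J.X), IsHypercover (K := K) (J := J) f →
      (LieNGroupoid.tangentHom f).IsQuasiIso ∧
        ∀ l x, Function.Surjective ((LieNGroupoid.tangentHom f).map l x)) ∧
    (∀ K J : LieNGroupoid.{u} n, MoritaEquivalent K J →
      K.tangentComplex.WeaklyEquivalent J.tangentComplex) ∧
    (∀ (m : ℕ) (K J : LieNGroupoid.{u} n) (f : J.X ⟶ K.X), IsHypercover (K := J) (J := K) f →
      ∀ α : SimplicialManifold.BiForm K.X, K.IsShiftedSymplectic m α →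
        J.IsShiftedSymplectic m (SimplicialManifold.BiForm.pullback f α)) := by
  refine ⟨fun K J f hf => ⟨hf.isQuasiIso_tangentHom, hf.surjective_tangentHom⟩, ?_,
    fun m K J f hf α hα => hf.isShiftedSymplectic_pullback hα⟩
  rintro K J ⟨Z, f, g, hf, hg⟩
  exact ⟨_, Z.tangentComplex, LieNGroupoid.tangentHom f, LieNGroupoid.tangentHom g,
    hf.isQuasiIso_tangentHom, hg.isQuasiIso_tangentHom⟩
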